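/- Let $\Omega\subset\mathbb R^2$ be a domain, i.e. a bounded connected open set with Lipschitz-continuous boundary, lying locally on one side of its boundary. Let $T>0$, $2.8\le p\le 5$, $p'=p/(p-1)$, $\alpha=\frac{3p-1}{2p}$ (so $1<\alpha<2$) and $\alpha'=\alpha/(\alpha-1)$. Let $\mu$ be a measurable function with $\mu_1\le\mu(x)\le\mu_2$ for all $x\in\overline\Omega$, where $\mu_1,\mu_2>0$ are constants, let $\tilde a\in W^{1,p}(0,T;\mathcal C^0(\overline\Omega))$, and let $u_0\in W_0^{1,p}(\Omega)$ with $u_0\ge 0$ a.e. in $\Omega$. Write $\{s\}^-=\max\{-s,0\}$, let $W_0^{1,p}(\Omega)$ carry the norm $\|v\|_{W_0^{1,p}(\Omega)}=\big(\|v\|_{L^p(\Omega)}^p+\|\nabla v\|_{L^p(\Omega)}^p\big)^{1/p}$, and let $W^{-1,p'}(\Omega)$ be its dual space with the dual norm; a function $f$ is identified with the functional $v\mapsto\int_\Omega fv\,dx$. The functions $|s|^{\alpha-2}s$ and $|s|^{(\alpha-2)/2}s$ are understood to be $0$ at $s=0$. For $\kappa>0$ and an integer $N\ge1$ put $\ell=T/N$.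 A semi-discrete solution for $(\kappa,N)$ is a family $u_{\kappa,\ell}^0,\dots,u_{\kappa,\ell}^N\in W_0^{1,p}(\Omega)$ with $u_{\kappa,\ell}^0=u_0$ such that, for every $0\le n\le N-1$, $$\frac{|u_{\kappa,\ell}^{n+1}|^{\alpha-2}u_{\kappa,\ell}^{n+1}-|u_{\kappa,\ell}^{n}|^{\alpha-2}u_{\kappa,\ell}^{n}}{\ell}-\nabla\cdot\left(\mu|\nabla u_{\kappa,\ell}^{n+1}|^{p-2}\nabla u_{\kappa,\ell}^{n+1}\right)-\frac{\{u_{\kappa,\ell}^{n+1}\}^-}{\kappa}=\frac1\ell\int_{n\ell}^{(n+1)\ell}\tilde a(t)\,dt\quad\text{in }W^{-1,p'}(\Omega).$$ Theorem. For every $C_1>0$ there is a constant $C>0$, independent of $\kappa$ and $N$ (it may depend on $\Omega,T,p,\mu,\tilde a,u_0,C_1$), such that for all $\kappa>0$, all integers $N\ge1$ and every semi-discrete solution for $(\kappa,N)$ that satisfies the stability condition $$\frac1\kappa\sum_{n=0}^{N-1}\int_\Omega\{u_{\kappa,\ell}^{n+1}\}^-\,(u_{\kappa,\ell}^{n+1}-u_{\kappa,\ell}^{n})\,dx\le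 C_1,\qquad\text{(SC1)}$$ the following estimates hold: $$\max_{0\le n\le N}\|u_{\kappa,\ell}^n\|_{L^\alpha(\Omega)}\le C,$$ $$\ell\sum_{n=0}^N\|u_{\kappa,\ell}^n\|_{W_0^{1,p}(\Omega)}^p\le C,$$ $$\ell\sum_{n=0}^{N-1}\left\|\frac{|u_{\kappa,\ell}^{n+1}|^{\frac{\alpha-2}{2}}u_{\kappa,\ell}^{n+1}-|u_{\kappa,\ell}^{n}|^{\frac{\alpha-2}{2}}u_{\kappa,\ell}^{n}}{\ell}\right\|_{L^2(\Omega)}^2\le C,$$ $$\max_{0\le n\le N}\left\||u_{\kappa,\ell}^n|^{\frac{\alpha-2}{2}}u_{\kappa,\ell}^n\right\|_{L^2(\Omega)}\le C,$$ $$\max_{0\le n\le N}\|u_{\kappa,\ell}^n\|_{W_0^{1,p}(\Omega)}\le C,$$ $$\max_{0\le n\le N-1}\left\|\frac{|u_{\kappa,\ell}^{n+1}|^{\alpha-2}u_{\kappa,\ell}^{n+1}-|u_{\kappa,\ell}^{n}|^{\alpha-2}u_{\kappa,\ell}^{n}}{\ell}\right\|_{W^{-1,p'}(\Omega)}\le C\left(1+\frac1\kappa\right),$$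 $$\max_{0\le n\le N}\left\||u_{\kappa,\ell}^n|^{\alpha-2}u_{\kappa,\ell}^n\right\|_{L^{\alpha'}(\Omega)}\le C.$$ -/

import Mathlib

open MeasureTheory Filter Topology
open scoped ENNReal ContDiff BoundedContinuousFunction

noncomputable section

namespace IceSheet

/-- The Euclidean plane. -/
abbrev Plane : Type := EuclideanSpace ℝ (Fin 2)

/-- A domain in the plane: a bounded, connected, open set that near each of its boundary points is,
in suitable orthonormal coordinates centred at the point, the set lying strictly above the graph of
a Lipschitz function (so that the set is locally on one side of its boundary). -/
def IsLipschitzDomain (Ω : Set Plane) : Prop :=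
  IsOpen Ω ∧ IsConnected Ω ∧ Bornology.IsBounded Ω ∧
    ∀ x₀ ∈ frontier Ω, ∃ (R : Plane ≃ₗᵢ[ℝ] Plane) (γ : ℝ → ℝ) (K : NNReal) (r : ℝ),
      0 < r ∧ LipschitzWith K γ ∧
        ∀ x ∈ Metric.ball x₀ r, x ∈ Ω ↔ γ (R (x - x₀) 0) < R (x - x₀) 1

/-- Smooth functions with compact support contained in `Ω`. -/
def IsTestFunction (Ω : Set Plane) (φ : Plane → ℝ) : Prop :=
  ContDiff ℝ ∞ φ ∧ HasCompactSupport φ ∧ tsupport φ ⊆ Ω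

/-- `G` is a weak (distributional) gradient of `u` in `Ω`. -/
def HasWeakGradient (Ω : Set Plane) (u : Plane → ℝ) (G : Plane → Plane) : Prop :=
  LocallyIntegrableOn u Ω ∧ LocallyIntegrableOn G Ω ∧
    ∀ φ : Plane → ℝ, IsTestFunction Ω φ →
      ∫ x in Ω, u x • gradient φ x = -∫ x in Ω, φ x • G x

open Classical in
/-- The weak gradient of `u` in `Ω` (a representative; it is zero if there is none). -/
def weakGradient (Ω : Set Plane) (u : Plane → ℝ) : Plane → Plane :=
  if h : ∃ G, HasWeakGradient Ω u G then h.choose else 0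

/-- `u` represents an element of the Sobolev space `W^{1,p}(Ω)`. -/
def MemW1 (Ω : Set Plane) (p : ℝ) (u : Plane → ℝ) : Prop :=
  MemLp u (ENNReal.ofReal p) (volume.restrict Ω) ∧
    ∃ G, HasWeakGradient Ω u G ∧ MemLp G (ENNReal.ofReal p) (volume.restrict Ω)

/-- The norm of `W^{1,p}(Ω)`, to be used on members of that space. -/
def w1Norm (Ω : Set Plane) (p : ℝ) (u : Plane → ℝ) : ℝ≥0∞ :=
  (eLpNorm u (ENNReal.ofReal p) (volume.restrict Ω) ^ p +
    eLpNorm (weakGradient Ω u) (ENNReal.ofReal p) (volume.restrict Ω) ^ p) ^ (1 / p)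

/-- `u` represents an element of `W_0^{1,p}(Ω)`, the closure of the test functions in
`W^{1,p}(Ω)`. -/
def MemW10 (Ω : Set Plane) (p : ℝ) (u : Plane → ℝ) : Prop :=
  MemW1 Ω p u ∧ ∃ φ : ℕ → Plane → ℝ, (∀ k, IsTestFunction Ω (φ k)) ∧
    Tendsto (fun k => w1Norm Ω p (fun x => u x - φ k x)) atTop (𝓝 0)

/-- The norm in `W^{-1,p'}(Ω)`, the dual of `W_0^{1,p}(Ω)`, of the functional
`v ↦ ∫_Ω f v`. -/
def dualNorm (Ω : Set Plane) (p : ℝ) (f : Plane → ℝ) : ℝ≥0∞ :=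
  ⨆ (v : Plane → ℝ) (_ : MemW10 Ω p v) (_ : w1Norm Ω p v ≤ 1), ‖∫ x in Ω, f x * v x‖ₑ

/-- `a` belongs to `W^{1,p}(0,T;X)`: it is in `L^p(0,T;X)` and has a weak derivative there. -/
def MemW1Time {X : Type*} [NormedAddCommGroup X] [NormedSpace ℝ X] (T p : ℝ) (a : ℝ → X) : Prop :=
  MemLp a (ENNReal.ofReal p) (volume.restrict (Set.Ioo 0 T)) ∧
    ∃ a' : ℝ → X, MemLp a' (ENNReal.ofReal p) (volume.restrict (Set.Ioo 0 T)) ∧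
      ∀ φ : ℝ → ℝ, ContDiff ℝ ∞ φ → HasCompactSupport φ → tsupport φ ⊆ Set.Ioo 0 T →
        ∫ t in Set.Ioo 0 T, deriv φ t • a t = -∫ t in Set.Ioo 0 T, φ t • a' t

open Classical in
/-- Extension by zero to the plane of a function on the closure of `Ω`. The bounded continuous
functions on the closure of a bounded `Ω` form the space `C^0` of that compact set, with the
maximum norm. -/
def extendZero {Ω : Set Plane} (f : closure Ω →ᵇ ℝ) (x : Plane) : ℝ :=
  if h : x ∈ closure Ω then f ⟨x, h⟩ else 0

/-- The negative part `{s}^- = (|s| - s)/2`. -/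
def negPart (s : ℝ) : ℝ := (|s| - s) / 2

/-- The odd power `|s|^q s`, which vanishes at zero. -/
def oddPow (q s : ℝ) : ℝ := |s| ^ q * s

/-- The exponent `α = (3p-1)/(2p)`. -/
def alpha (p : ℝ) : ℝ := (3 * p - 1) / (2 * p)

/-- The time step `ℓ = T/N`. -/
def step (T : ℝ) (N : ℕ) : ℝ := T / N

/-- `(u^n)_{0 ≤ n ≤ N}` solves the penalized semi-discrete scheme: all its terms lie in
`W_0^{1,p}(Ω)`, `u^0 = u₀`, and each step from `n` to `n + 1 ≤ N` satisfies, in `W^{-1,p'}(Ω)`, the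
equation whose weak form is displayed here; its right-hand side is the mean of `a` over the time
interval from `nℓ` to `(n+1)ℓ`. -/
def IsSemiDiscreteSolution (Ω : Set Plane) (p T : ℝ) (μ : Plane → ℝ) (a : ℝ → closure Ω →ᵇ ℝ)
    (u₀ : Plane → ℝ) (κ : ℝ) (N : ℕ) (u : ℕ → Plane → ℝ) : Prop :=
  u 0 =ᵐ[volume.restrict Ω] u₀ ∧ (∀ n ≤ N, MemW10 Ω p (u n)) ∧
    ∀ n < N, ∀ v : Plane → ℝ, MemW10 Ω p v →
      1 / step T N * (∫ x in Ω,
          (oddPow (alpha p - 2) (u (n + 1) x) - oddPow (alpha p - 2) (u n x)) * v x)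
        + (∫ x in Ω, μ x * (‖weakGradient Ω (u (n + 1)) x‖ ^ (p - 2) *
            inner ℝ (weakGradient Ω (u (n + 1)) x) (weakGradient Ω v x)))
        - 1 / κ * (∫ x in Ω, negPart (u (n + 1) x) * v x)
      = ∫ x in Ω, extendZero
          ((1 / step T N) • ∫ t in (n * step T N)..((n + 1) * step T N), a t) x * v x

end IceSheet

end

/-!
Test the step from `u n` to `u (n + 1)` with `u (n + 1) - u n`. The power inequality
`(|v|^(α-2) v - |u|^(α-2) u) (v - u) ≥ (α-1) (|v|^((α-2)/2) v - |u|^((α-2)/2) u) ^ 2` produces the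
dissipation, convexity turns the `p`-Laplacian into a telescoping sum of gradient energies, and
the penalty term dominates a telescoping sum of `∫ ({u}⁻)² / (2κ)`, whose initial value vanishes
because `u₀ ≥ 0`. The source is summed by parts in time: the averages of a `W^{1,p}(0,T)` function
have total variation bounded independently of `N`, so that only `∫ |u n|` remains, which Poincaré's
and Young's inequalities absorb into the largest gradient energy. Every estimate follows from
the resulting bound on `u n` in `W_0^{1,p}`, uniform in `n`, and on the total dissipation.
-/

noncomputable section

namespace IceSheet

/-! ### Pointwise inequalities -/

section Pointwise

lemma measurable_oddPow (q : ℝ) : Measurable (oddPow q) := by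
  unfold oddPow
  fun_prop

lemma oddPow_neg (q s : ℝ) : oddPow q (-s) = -oddPow q s := by
  simp [oddPow]

lemma abs_oddPow {q : ℝ} (hq : -1 < q) (s : ℝ) : |oddPow q s| = |s| ^ (q + 1) := by
  rw [oddPow, abs_mul, Real.rpow_add_one' (abs_nonneg s) (by linarith),
    abs_of_nonneg (Real.rpow_nonneg (abs_nonneg s) q)]

lemma oddPow_of_nonneg {q s : ℝ} (hq : -1 < q) (hs : 0 ≤ s) : oddPow q s = s ^ (q + 1) := by
  rw [oddPow, abs_of_nonneg hs, Real.rpow_add_one' hs (by linarith)]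

lemma sub_one_mul_sq_rpow_sub_rpow_le {α r s : ℝ} (hα : 1 < α) (hα₂ : α ≤ 2) (hr : 0 ≤ r)
    (hrs : r ≤ s) :
    (α - 1) * (s ^ (α / 2) - r ^ (α / 2)) ^ 2 ≤ (s ^ (α - 1) - r ^ (α - 1)) * (s - r) := by
  have hs : 0 ≤ s := hr.trans hrs
  rcases hs.eq_or_lt with rfl | hs₀
  · simp [le_antisymm hrs hr]
  -- By homogeneity only the ratio `t = r / s ∈ [0, 1]` matters.
  obtain ⟨t, rfl⟩ : ∃ t, r = s * t := ⟨r / s, by field_simp⟩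
  have ht : 0 ≤ t := nonneg_of_mul_nonneg_right hr hs₀
  have ht₁ : t ≤ 1 := le_of_mul_le_mul_left (by simpa using hrs) hs₀
  have hsq : (s ^ (α / 2)) ^ 2 = s ^ (α - 1) * s := by
    rw [← Real.rpow_natCast, ← Real.rpow_mul hs, ← Real.rpow_add_one hs₀.ne']
    ring_nf
  have bernoulli : t ^ (α - 1) ≤ 1 + (α - 1) * (t - 1) := by
    simpa using rpow_one_add_le_one_add_mul_self (s := t - 1) (by linarith)
      (p := α - 1) (by linarith) (by linarith)
  have le_rpow : t ≤ t ^ (α / 2) :=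
    Real.self_le_rpow_of_le_one ht ht₁ (by linarith)
  have rpow_le : t ^ (α / 2) ≤ 1 := Real.rpow_le_one ht ht₁ (by linarith)
  rw [Real.mul_rpow hs ht, Real.mul_rpow hs ht]
  calc (α - 1) * (s ^ (α / 2) - s ^ (α / 2) * t ^ (α / 2)) ^ 2
      = (s ^ (α / 2)) ^ 2 * ((α - 1) * (1 - t ^ (α / 2)) ^ 2) := by ring
    _ ≤ (s ^ (α - 1) * s) * ((α - 1) * (1 - t) ^ 2) := by rw [hsq]; gcongr
    _ = (s ^ (α - 1) * s) * (((α - 1) * (1 - t)) * (1 - t)) := by ring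
    _ ≤ (s ^ (α - 1) * s) * ((1 - t ^ (α - 1)) * (1 - t)) := by gcongr; linarith
    _ = _ := by ring

lemma sq_rpow_add_rpow_le {α r s : ℝ} (hα : 1 < α) (hr : 0 ≤ r) (hs : 0 ≤ s) :
    (s ^ (α / 2) + r ^ (α / 2)) ^ 2 ≤ (s ^ (α - 1) + r ^ (α - 1)) * (s + r) := by
  have hmul {x : ℝ} (hx : 0 ≤ x) : x ^ (α / 2) = x ^ ((α - 1) / 2) * √x := by
    rw [Real.sqrt_eq_rpow, ← Real.rpow_add' hx (by linarith)]
    ring_nf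
  have hsq {x : ℝ} (hx : 0 ≤ x) : x ^ (α - 1) = (x ^ ((α - 1) / 2)) ^ 2 := by
    rw [← Real.rpow_mul_natCast hx]
    norm_num
  rw [hmul hr, hmul hs, hsq hr, hsq hs]
  calc (s ^ ((α - 1) / 2) * √s + r ^ ((α - 1) / 2) * √r) ^ 2
      ≤ ((s ^ ((α - 1) / 2)) ^ 2 + (r ^ ((α - 1) / 2)) ^ 2) * (√s ^ 2 + √r ^ 2) := by
        linarith [sq_nonneg (s ^ ((α - 1) / 2) * √r - r ^ ((α - 1) / 2) * √s)]
    _ = _ := by rw [Real.sq_sqrt hs, Real.sq_sqrt hr]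

theorem oddPow_strong_monotone {α : ℝ} (hα : 1 < α) (hα₂ : α ≤ 2) (r s : ℝ) :
    (α - 1) * (oddPow ((α - 2) / 2) s - oddPow ((α - 2) / 2) r) ^ 2 ≤
      (oddPow (α - 2) s - oddPow (α - 2) r) * (s - r) := by
  wlog hrs : r ≤ s generalizing r s
  · linarith [this s r (le_of_not_ge hrs)]
  have half {x : ℝ} (hx : 0 ≤ x) : oddPow ((α - 2) / 2) x = x ^ (α / 2) := by
    rw [oddPow_of_nonneg (by linarith) hx]
    ring_nf
  have full {x : ℝ} (hx : 0 ≤ x) : oddPow (α - 2) x = x ^ (α - 1) := by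
    rw [oddPow_of_nonneg (by linarith) hx]
    ring_nf
  have same_sign {x y : ℝ} (hx : 0 ≤ x) (hxy : x ≤ y) :
      (α - 1) * (oddPow ((α - 2) / 2) y - oddPow ((α - 2) / 2) x) ^ 2 ≤
        (oddPow (α - 2) y - oddPow (α - 2) x) * (y - x) := by
    rw [half hx, half (hx.trans hxy), full hx, full (hx.trans hxy)]
    exact sub_one_mul_sq_rpow_sub_rpow_le hα hα₂ hx hxy
  rcases le_total 0 r with hr | hr
  · exact same_sign hr hrs
  have hr' : 0 ≤ -r := by linarith
  obtain ⟨x, rfl⟩ : ∃ x, r = -x := ⟨-r, by ring⟩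
  rw [neg_neg] at hr'
  rcases le_total 0 s with hs | hs
  · rw [oddPow_neg, oddPow_neg, half hr', half hs, full hr', full hs]
    simp only [sub_neg_eq_add]
    exact (mul_le_of_le_one_left (sq_nonneg _) (by linarith)).trans (sq_rpow_add_rpow_le hα hr' hs)
  · have := same_sign (x := -s) (y := x) (by linarith) (by linarith)
    simp only [oddPow_neg] at this ⊢
    linarith

theorem rpow_norm_sub_le_inner {E : Type*} [NormedAddCommGroup E] [InnerProductSpace ℝ E] {p : ℝ}
    (hp : 1 ≤ p) (ξ η : E) :
    (‖ξ‖ ^ p - ‖η‖ ^ p) / p ≤ ‖ξ‖ ^ (p - 2) * inner ℝ ξ (ξ - η) := by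
  have hp₀ : 0 < p := by linarith
  rcases eq_or_ne ξ 0 with rfl | hξ
  · have : 0 ≤ ‖η‖ ^ p / p := by positivity
    simpa [Real.zero_rpow hp₀.ne', neg_div]
  have hξ₀ : 0 < ‖ξ‖ := norm_pos_iff.2 hξ
  have young : ‖ξ‖ ^ (p - 1) * ‖η‖ ≤ (1 - 1 / p) * ‖ξ‖ ^ p + 1 / p * ‖η‖ ^ p := by
    have := Real.geom_mean_le_arith_mean2_weighted (w₁ := 1 - 1 / p) (w₂ := 1 / p)
      (p₁ := ‖ξ‖ ^ p) (p₂ := ‖η‖ ^ p) (by rw [sub_nonneg, div_le_one hp₀]; linarith)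
      (by positivity) (by positivity) (by positivity) (by ring)
    rw [← Real.rpow_mul (norm_nonneg _), ← Real.rpow_mul (norm_nonneg _)] at this
    rwa [show p * (1 - 1 / p) = p - 1 by field_simp, mul_one_div_cancel hp₀.ne',
      Real.rpow_one] at this
  have cauchy_schwarz : ‖ξ‖ ^ (p - 2) * inner ℝ ξ η ≤ ‖ξ‖ ^ (p - 1) * ‖η‖ := by
    calc ‖ξ‖ ^ (p - 2) * inner ℝ ξ η ≤ ‖ξ‖ ^ (p - 2) * (‖ξ‖ * ‖η‖) := by
          gcongr; exact real_inner_le_norm ξ η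
      _ = ‖ξ‖ ^ (p - 1) * ‖η‖ := by
          rw [← mul_assoc, ← Real.rpow_add_one hξ₀.ne']
          ring_nf
  have diagonal : ‖ξ‖ ^ (p - 2) * inner ℝ ξ ξ = ‖ξ‖ ^ p := by
    rw [real_inner_self_eq_norm_sq, ← Real.rpow_add_natCast hξ₀.ne']
    norm_num
  rw [inner_sub_right, mul_sub, diagonal, sub_div, div_eq_mul_one_div, div_eq_mul_one_div (_ ^ _)]
  linarith

lemma measurable_negPart : Measurable negPart := by
  unfold negPart
  fun_prop

lemma negPart_nonneg (s : ℝ) : 0 ≤ negPart s := by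
  unfold negPart
  linarith [le_abs_self s]

lemma negPart_le_abs (s : ℝ) : negPart s ≤ |s| := by
  unfold negPart
  linarith [neg_abs_le s]

lemma negPart_of_nonneg {s : ℝ} (hs : 0 ≤ s) : negPart s = 0 := by
  simp [negPart, abs_of_nonneg hs]

lemma negPart_mul_sub_le (s r : ℝ) :
    negPart s * (s - r) ≤ (negPart r ^ 2 - negPart s ^ 2) / 2 := by
  have hs : negPart s * s = -negPart s ^ 2 := by
    unfold negPart
    linarith [sq_abs s]
  have hr : -r ≤ negPart r := by
    unfold negPart
    linarith [neg_le_abs r]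
  linarith [mul_le_mul_of_nonneg_left hr (negPart_nonneg s),
    two_mul_le_add_sq (negPart s) (negPart r)]

lemma rpow_le_one_add_rpow {s q p : ℝ} (hs : 0 ≤ s) (hq : 0 ≤ q) (hqp : q ≤ p) :
    s ^ q ≤ 1 + s ^ p := by
  rcases le_total s 1 with h | h
  · linarith [Real.rpow_le_one hs h hq, Real.rpow_nonneg hs p]
  · linarith [Real.rpow_le_rpow_of_exponent_le h hqp]

lemma rpow_sub_one_mul_le {s t p : ℝ} (hs : 0 ≤ s) (ht : 0 ≤ t) (hp : 1 ≤ p) :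
    s ^ (p - 1) * t ≤ s ^ p + t ^ p := by
  have : 0 ≤ p - 1 := by linarith
  have hm₀ : 0 ≤ max s t := le_max_of_le_left hs
  calc s ^ (p - 1) * t ≤ max s t ^ (p - 1) * max s t := by
        gcongr
        exacts [le_max_left s t, le_max_right s t]
    _ = max s t ^ p := by rw [← Real.rpow_add_one' hm₀ (by linarith), sub_add_cancel]
    _ ≤ s ^ p + t ^ p := by
        rcases max_choice s t with h | h <;> rw [h]
        · linarith [Real.rpow_nonneg ht p]
        · linarith [Real.rpow_nonneg hs p]

lemma abs_rpow_mul_inner_le {E : Type*} [NormedAddCommGroup E] [InnerProductSpace ℝ E] {p : ℝ}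
    (hp : 1 < p) (ξ η : E) : |‖ξ‖ ^ (p - 2) * inner ℝ ξ η| ≤ ‖ξ‖ ^ p + ‖η‖ ^ p := by
  calc |‖ξ‖ ^ (p - 2) * inner ℝ ξ η| ≤ ‖ξ‖ ^ (p - 2) * (‖ξ‖ * ‖η‖) := by
        rw [abs_mul, abs_of_nonneg (by positivity : 0 ≤ ‖ξ‖ ^ (p - 2))]
        gcongr
        exact abs_real_inner_le_norm ξ η
    _ = ‖ξ‖ ^ (p - 1) * ‖η‖ := by
        rw [← mul_assoc, ← Real.rpow_add_one' (norm_nonneg _) (by linarith)]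
        ring_nf
    _ ≤ ‖ξ‖ ^ p + ‖η‖ ^ p := rpow_sub_one_mul_le (norm_nonneg ξ) (norm_nonneg η) hp.le

lemma le_mul_rpow_add {s p ε : ℝ} (hs : 0 ≤ s) (hp : 1 < p) (hε : 0 < ε) :
    s ≤ ε * s ^ p + (1 / ε) ^ (1 / (p - 1)) := by
  have hp₁ : 0 < p - 1 := by linarith
  rcases le_total s ((1 / ε) ^ (1 / (p - 1))) with h | h
  · have := mul_nonneg hε.le (Real.rpow_nonneg hs p)
    linarith
  · have hle : 1 / ε ≤ s ^ (p - 1) := by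
      calc 1 / ε = ((1 / ε) ^ (1 / (p - 1))) ^ (p - 1) := by
            rw [← Real.rpow_mul (by positivity), one_div_mul_cancel hp₁.ne', Real.rpow_one]
        _ ≤ s ^ (p - 1) := by gcongr
    calc s = ε * (1 / ε * s) := by field_simp
      _ ≤ ε * (s ^ (p - 1) * s) := by gcongr
      _ = ε * s ^ p := by rw [← Real.rpow_add_one' hs (by linarith), sub_add_cancel]
      _ ≤ ε * s ^ p + (1 / ε) ^ (1 / (p - 1)) := le_add_of_nonneg_right (by positivity)

lemma one_lt_alpha {p : ℝ} (hp : 1 < p) : 1 < alpha p := by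
  rw [alpha, lt_div_iff₀ (by linarith)]
  linarith

lemma alpha_le_two {p : ℝ} (hp : 0 < p) : alpha p ≤ 2 := by
  rw [alpha, div_le_iff₀ (by linarith)]
  linarith

end Pointwise

/-! ### Lebesgue norms -/

section Lebesgue

variable {X E : Type*} [MeasurableSpace X] {ν : Measure X} [NormedAddCommGroup E]

lemma integrable_norm_rpow_of_memLp_ofReal {f : X → E} {p : ℝ} (hp : 0 < p)
    (hf : MemLp f (ENNReal.ofReal p) ν) : Integrable (fun x => ‖f x‖ ^ p) ν := by
  simpa [ENNReal.toReal_ofReal hp.le] using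
    hf.integrable_norm_rpow (by simpa using hp) ENNReal.ofReal_ne_top

lemma eLpNorm_ofReal_rpow_eq {f : X → E} {p : ℝ} (hp : 0 < p)
    (hf : MemLp f (ENNReal.ofReal p) ν) :
    eLpNorm f (ENNReal.ofReal p) ν ^ p = ENNReal.ofReal (∫ x, ‖f x‖ ^ p ∂ν) := by
  have h₀ : 0 ≤ ∫ x, ‖f x‖ ^ p ∂ν := integral_nonneg fun x => by positivity
  rw [hf.eLpNorm_eq_integral_rpow_norm (by simpa using hp) ENNReal.ofReal_ne_top,
    ENNReal.toReal_ofReal hp.le, ENNReal.ofReal_rpow_of_nonneg (by positivity) hp.le,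
    Real.rpow_inv_rpow h₀ hp.ne']

lemma eLpNorm_le_eLpNorm_mul_of_support_subset {f : X → E} {s : Set X} (hfs : f.support ⊆ s)
    (hf : AEStronglyMeasurable f ν) {q p : ℝ≥0∞} (hqp : q ≤ p) :
    eLpNorm f q ν ≤ eLpNorm f p ν * ν s ^ (1 / q.toReal - 1 / p.toReal) := by
  have := eLpNorm_le_eLpNorm_mul_rpow_measure_univ hqp (hf.restrict (s := s))
  rwa [eLpNorm_restrict_eq_of_support_subset hfs, eLpNorm_restrict_eq_of_support_subset hfs,
    Measure.restrict_apply_univ] at this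

lemma eLpNorm_oddPow {q r : ℝ} (hq : -1 < q) (hr : 0 ≤ r) (u : X → ℝ) :
    eLpNorm (fun x => oddPow q (u x)) (ENNReal.ofReal r) ν =
      eLpNorm u (ENNReal.ofReal (r * (q + 1))) ν ^ (q + 1) := by
  rw [← eLpNorm_norm]
  simp only [Real.norm_eq_abs, abs_oddPow hq]
  simp only [← Real.norm_eq_abs]
  rw [eLpNorm_norm_rpow _ (by linarith), ENNReal.ofReal_mul hr]

lemma memLp_oddPow {q r : ℝ} (hq : -1 < q) (hr : 0 ≤ r) {u : X → ℝ}
    (hu : MemLp u (ENNReal.ofReal (r * (q + 1))) ν) :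
    MemLp (fun x => oddPow q (u x)) (ENNReal.ofReal r) ν := by
  refine ⟨(measurable_oddPow q).comp_aemeasurable hu.1.aemeasurable |>.aestronglyMeasurable, ?_⟩
  rw [eLpNorm_oddPow hq hr]
  exact ENNReal.rpow_lt_top_of_nonneg (by linarith) hu.2.ne

end Lebesgue

/-! ### Weak gradients -/

section Gradient

variable {E : Type*} [NormedAddCommGroup E] [InnerProductSpace ℝ E] [CompleteSpace E]

lemma norm_gradient (φ : E → ℝ) (x : E) : ‖gradient φ x‖ = ‖fderiv ℝ φ x‖ := by
  rw [← toDual_gradient, LinearIsometryEquiv.norm_map]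

lemma tsupport_gradient_subset (φ : E → ℝ) : tsupport (gradient φ) ⊆ tsupport φ :=
  (tsupport_comp_subset (map_zero (InnerProductSpace.toDual ℝ E).symm) _).trans
    (tsupport_fderiv_subset ℝ)

end Gradient

section LocallyIntegrable

variable {X E : Type*} [TopologicalSpace X] [T2Space X] [MeasurableSpace X]
  [OpensMeasurableSpace X] {ν : Measure X} [NormedAddCommGroup E] [NormedSpace ℝ E] {s : Set X}

lemma integrableOn_smul_of_hasCompactSupport_left {φ : X → ℝ} {f : X → E} (hφ : Continuous φ)
    (hφc : HasCompactSupport φ) (hφs : tsupport φ ⊆ s) (hf : LocallyIntegrableOn f s ν) :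
    IntegrableOn (fun x => φ x • f x) s ν := by
  have hK : IntegrableOn (fun x => φ x • f x) (tsupport φ) ν :=
    (hf.integrableOn_compact_subset hφs hφc).continuousOn_smul hφ.continuousOn hφc
  refine ((integrableOn_iff_integrable_of_support_subset fun x hx => ?_).1 hK).integrableOn
  exact subset_tsupport φ (left_ne_zero_of_smul hx)

lemma integrableOn_smul_of_hasCompactSupport_right [SecondCountableTopologyEither X E] {f : X → ℝ}
    {g : X → E} (hg : Continuous g) (hgc : HasCompactSupport g) (hgs : tsupport g ⊆ s)
    (hf : LocallyIntegrableOn f s ν) : IntegrableOn (fun x => f x • g x) s ν := by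
  have hK : IntegrableOn (fun x => f x • g x) (tsupport g) ν :=
    (hf.integrableOn_compact_subset hgs hgc).smul_continuousOn hg.continuousOn hgc
  refine ((integrableOn_iff_integrable_of_support_subset fun x hx => ?_).1 hK).integrableOn
  exact subset_tsupport g (right_ne_zero_of_smul hx)

end LocallyIntegrable

section WeakGradient

variable {Ω : Set Plane} {φ : Plane → ℝ}

lemma IsTestFunction.continuous (hφ : IsTestFunction Ω φ) : Continuous φ :=
  hφ.1.continuous

lemma IsTestFunction.continuous_fderiv (hφ : IsTestFunction Ω φ) : Continuous (fderiv ℝ φ) :=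
  hφ.1.continuous_fderiv (by simp)

lemma IsTestFunction.continuous_gradient (hφ : IsTestFunction Ω φ) : Continuous (gradient φ) :=
  (InnerProductSpace.toDual ℝ Plane).symm.continuous.comp hφ.continuous_fderiv

lemma IsTestFunction.hasCompactSupport_gradient (hφ : IsTestFunction Ω φ) :
    HasCompactSupport (gradient φ) :=
  hφ.2.1.of_isClosed_subset (isClosed_tsupport _) (tsupport_gradient_subset φ)

lemma IsTestFunction.support_subset (hφ : IsTestFunction Ω φ) : φ.support ⊆ Ω :=
  (subset_tsupport φ).trans hφ.2.2

lemma IsTestFunction.tsupport_gradient_subset (hφ : IsTestFunction Ω φ) :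
    tsupport (gradient φ) ⊆ Ω :=
  (IceSheet.tsupport_gradient_subset φ).trans hφ.2.2

lemma IsTestFunction.sub {ψ : Plane → ℝ} (hφ : IsTestFunction Ω φ) (hψ : IsTestFunction Ω ψ) :
    IsTestFunction Ω (fun x => φ x - ψ x) :=
  ⟨hφ.1.sub hψ.1, hφ.2.1.sub hψ.2.1,
    (tsupport_sub φ ψ).trans (Set.union_subset hφ.2.2 hψ.2.2)⟩

lemma IsTestFunction.setIntegral_smul {E : Type*} [NormedAddCommGroup E] [NormedSpace ℝ E]
    (hφ : IsTestFunction Ω φ) (f : Plane → E) : ∫ x in Ω, φ x • f x = ∫ x, φ x • f x :=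
  setIntegral_eq_integral_of_forall_compl_eq_zero fun x hx => by
    rw [Function.notMem_support.1 fun h => hx (hφ.support_subset h), zero_smul]

lemma HasWeakGradient.sub {u v : Plane → ℝ} {G H : Plane → Plane} (hu : HasWeakGradient Ω u G)
    (hv : HasWeakGradient Ω v H) :
    HasWeakGradient Ω (fun x => u x - v x) (fun x => G x - H x) := by
  refine ⟨hu.1.sub hv.1, hu.2.1.sub hv.2.1, fun φ hφ => ?_⟩
  have integrable_left {f : Plane → Plane} (hf : LocallyIntegrableOn f Ω) :
      IntegrableOn (fun x => φ x • f x) Ω :=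
    integrableOn_smul_of_hasCompactSupport_left hφ.continuous hφ.2.1 hφ.2.2 hf
  have integrable_right {f : Plane → ℝ} (hf : LocallyIntegrableOn f Ω) :
      IntegrableOn (fun x => f x • gradient φ x) Ω :=
    integrableOn_smul_of_hasCompactSupport_right hφ.continuous_gradient
      hφ.hasCompactSupport_gradient hφ.tsupport_gradient_subset hf
  simp only [sub_smul, smul_sub]
  rw [integral_sub (integrable_right hu.1) (integrable_right hv.1),
    integral_sub (integrable_left hu.2.1) (integrable_left hv.2.1), hu.2.2 φ hφ, hv.2.2 φ hφ]
  abel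

theorem HasWeakGradient.ae_eq (hΩ : IsOpen Ω) {u v : Plane → ℝ} {G H : Plane → Plane}
    (hu : HasWeakGradient Ω u G) (hv : HasWeakGradient Ω v H)
    (huv : u =ᵐ[volume.restrict Ω] v) : G =ᵐ[volume.restrict Ω] H := by
  have hGH : ∀ᵐ x, x ∈ Ω → (G - H) x = 0 := by
    refine hΩ.ae_eq_zero_of_integral_contDiff_smul_eq_zero (hu.2.1.sub hv.2.1)
      fun φ hφ₁ hφ₂ hφ₃ => ?_
    have hφ : IsTestFunction Ω φ := ⟨hφ₁, hφ₂, hφ₃⟩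
    have integrable {f : Plane → Plane} (hf : LocallyIntegrableOn f Ω) :
        IntegrableOn (fun x => φ x • f x) Ω :=
      integrableOn_smul_of_hasCompactSupport_left hφ.continuous hφ.2.1 hφ.2.2 hf
    rw [← hφ.setIntegral_smul]
    simp only [Pi.sub_apply, smul_sub]
    rw [integral_sub (integrable hu.2.1) (integrable hv.2.1), sub_eq_zero, ← neg_inj,
      ← hu.2.2 φ hφ, ← hv.2.2 φ hφ]
    refine integral_congr_ae ?_
    filter_upwards [huv] with x hx
    rw [hx]
  rw [EventuallyEq, ae_restrict_iff' hΩ.measurableSet]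
  filter_upwards [hGH] with x hx hxΩ
  exact sub_eq_zero.1 (hx hxΩ)

lemma HasWeakGradient.weakGradient {u : Plane → ℝ} {G : Plane → Plane}
    (hu : HasWeakGradient Ω u G) : HasWeakGradient Ω u (weakGradient Ω u) := by
  have h : ∃ G, HasWeakGradient Ω u G := ⟨G, hu⟩
  rw [IceSheet.weakGradient, dif_pos h]
  exact h.choose_spec

lemma HasWeakGradient.weakGradient_ae_eq (hΩ : IsOpen Ω) {u : Plane → ℝ} {G : Plane → Plane}
    (hu : HasWeakGradient Ω u G) : IceSheet.weakGradient Ω u =ᵐ[volume.restrict Ω] G :=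
  hu.weakGradient.ae_eq hΩ hu (ae_eq_refl _)

theorem IsTestFunction.hasWeakGradient (hφ : IsTestFunction Ω φ) :
    HasWeakGradient Ω φ (gradient φ) := by
  refine ⟨hφ.continuous.locallyIntegrable.locallyIntegrableOn Ω,
    hφ.continuous_gradient.locallyIntegrable.locallyIntegrableOn Ω, fun ψ hψ => ?_⟩
  rw [hφ.setIntegral_smul, hψ.setIntegral_smul]
  have integrable_left : Integrable (fun x => φ x • gradient ψ x) :=
    (hφ.continuous.smul hψ.continuous_gradient).integrable_of_hasCompactSupport
      hφ.2.1.smul_right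
  have integrable_right : Integrable (fun x => ψ x • gradient φ x) :=
    (hψ.continuous.smul hφ.continuous_gradient).integrable_of_hasCompactSupport
      hψ.2.1.smul_right
  refine ext_inner_left ℝ fun v => ?_
  rw [inner_neg_right, ← integral_inner integrable_left, ← integral_inner integrable_right]
  simp only [inner_smul_right, inner_gradient_right, conj_trivial]
  have hφ' : Continuous fun x => fderiv ℝ φ x v := hφ.continuous_fderiv.clm_apply continuous_const
  have hψ' : Continuous fun x => fderiv ℝ ψ x v := hψ.continuous_fderiv.clm_apply continuous_const
  rw [integral_mul_fderiv_eq_neg_fderiv_mul_of_integrable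
    ((hφ'.mul hψ.continuous).integrable_of_hasCompactSupport hψ.2.1.mul_left)
    ((hφ.continuous.mul hψ').integrable_of_hasCompactSupport hφ.2.1.mul_right)
    ((hφ.continuous.mul hψ.continuous).integrable_of_hasCompactSupport hφ.2.1.mul_right)
    (fun x _ => hφ.1.differentiable (by simp) x) (fun x _ => hψ.1.differentiable (by simp) x)]
  simp only [mul_comm]

end WeakGradient

/-! ### Sobolev spaces -/

section Sobolev

variable {Ω : Set Plane} {p : ℝ} {u v φ : Plane → ℝ}

lemma IsTestFunction.memLp (hφ : IsTestFunction Ω φ) (q : ℝ≥0∞) :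
    MemLp φ q (volume.restrict Ω) :=
  (hφ.continuous.memLp_of_hasCompactSupport hφ.2.1).restrict Ω

lemma IsTestFunction.memW1 (hφ : IsTestFunction Ω φ) (p : ℝ) : MemW1 Ω p φ :=
  ⟨hφ.memLp _, gradient φ, hφ.hasWeakGradient,
    (hφ.continuous_gradient.memLp_of_hasCompactSupport hφ.hasCompactSupport_gradient).restrict Ω⟩

lemma MemW1.hasWeakGradient (hu : MemW1 Ω p u) : HasWeakGradient Ω u (weakGradient Ω u) := by
  obtain ⟨-, G, hG, -⟩ := hu
  exact hG.weakGradient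

lemma MemW1.memLp_weakGradient (hΩ : IsOpen Ω) (hu : MemW1 Ω p u) :
    MemLp (weakGradient Ω u) (ENNReal.ofReal p) (volume.restrict Ω) := by
  obtain ⟨-, G, hG, hGp⟩ := hu
  exact hGp.ae_eq (hG.weakGradient_ae_eq hΩ).symm

lemma MemW1.sub (hΩ : IsOpen Ω) (hu : MemW1 Ω p u) (hv : MemW1 Ω p v) :
    MemW1 Ω p (fun x => u x - v x) :=
  ⟨hu.1.sub hv.1, _, hu.hasWeakGradient.sub hv.hasWeakGradient,
    (hu.memLp_weakGradient hΩ).sub (hv.memLp_weakGradient hΩ)⟩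

lemma MemW1.weakGradient_sub (hΩ : IsOpen Ω) (hu : MemW1 Ω p u) (hv : MemW1 Ω p v) :
    weakGradient Ω (fun x => u x - v x) =ᵐ[volume.restrict Ω]
      fun x => weakGradient Ω u x - weakGradient Ω v x :=
  (hu.hasWeakGradient.sub hv.hasWeakGradient).weakGradient_ae_eq hΩ

lemma MemW1.eLpNorm_weakGradient_sub_le (hΩ : IsOpen Ω) (hp : 1 ≤ p) (hu : MemW1 Ω p u)
    (hv : MemW1 Ω p v) :
    eLpNorm (weakGradient Ω fun x => u x - v x) (ENNReal.ofReal p) (volume.restrict Ω) ≤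
      eLpNorm (weakGradient Ω u) (ENNReal.ofReal p) (volume.restrict Ω) +
        eLpNorm (weakGradient Ω v) (ENNReal.ofReal p) (volume.restrict Ω) := by
  rw [eLpNorm_congr_ae (hu.weakGradient_sub hΩ hv)]
  exact eLpNorm_sub_le (hu.memLp_weakGradient hΩ).1 (hv.memLp_weakGradient hΩ).1 (by simpa)

lemma eLpNorm_le_w1Norm (Ω : Set Plane) (hp : 0 < p) (u : Plane → ℝ) :
    eLpNorm u (ENNReal.ofReal p) (volume.restrict Ω) ≤ w1Norm Ω p u := by
  rw [w1Norm, one_div, ENNReal.le_rpow_inv_iff hp]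
  exact le_self_add

lemma eLpNorm_weakGradient_le_w1Norm (Ω : Set Plane) (hp : 0 < p) (u : Plane → ℝ) :
    eLpNorm (weakGradient Ω u) (ENNReal.ofReal p) (volume.restrict Ω) ≤ w1Norm Ω p u := by
  rw [w1Norm, one_div, ENNReal.le_rpow_inv_iff hp]
  exact le_add_self

lemma tendsto_w1Norm_zero (hp : 0 < p) {w : ℕ → Plane → ℝ}
    (hw : Tendsto (fun k => eLpNorm (w k) (ENNReal.ofReal p) (volume.restrict Ω)) atTop (𝓝 0))
    (hw' : Tendsto (fun k => eLpNorm (weakGradient Ω (w k)) (ENNReal.ofReal p)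
      (volume.restrict Ω)) atTop (𝓝 0)) :
    Tendsto (fun k => w1Norm Ω p (w k)) atTop (𝓝 0) := by
  have h := ((hw.ennrpow_const p).add (hw'.ennrpow_const p)).ennrpow_const (1 / p)
  rwa [ENNReal.zero_rpow_of_pos hp, add_zero, ENNReal.zero_rpow_of_pos (by positivity)] at h

/-- The `p`-th power of the norm of `W^{1,p}(Ω)`, as a real number. -/
def sobolevEnergy (Ω : Set Plane) (p : ℝ) (u : Plane → ℝ) : ℝ :=
  (∫ x in Ω, |u x| ^ p) + ∫ x in Ω, ‖weakGradient Ω u x‖ ^ p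

lemma w1Norm_rpow_eq (hΩ : IsOpen Ω) (hp : 0 < p) (hu : MemW1 Ω p u) :
    w1Norm Ω p u ^ p = ENNReal.ofReal (sobolevEnergy Ω p u) := by
  rw [w1Norm, one_div, ENNReal.rpow_inv_rpow hp.ne', eLpNorm_ofReal_rpow_eq hp hu.1,
    eLpNorm_ofReal_rpow_eq hp (hu.memLp_weakGradient hΩ),
    ← ENNReal.ofReal_add (integral_nonneg fun x => by positivity)
      (integral_nonneg fun x => by positivity)]
  rfl

lemma MemW10.sub (hΩ : IsOpen Ω) (hp : 1 ≤ p) (hu : MemW10 Ω p u) (hv : MemW10 Ω p v) :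
    MemW10 Ω p (fun x => u x - v x) := by
  have hp₀ : 0 < p := by linarith
  obtain ⟨hu, φ, hφ, hφu⟩ := hu
  obtain ⟨hv, ψ, hψ, hψv⟩ := hv
  refine ⟨hu.sub hΩ hv, fun k x => φ k x - ψ k x, fun k => (hφ k).sub (hψ k), ?_⟩
  have huφ k := hu.sub hΩ ((hφ k).memW1 p)
  have hvψ k := hv.sub hΩ ((hψ k).memW1 p)
  have regroup k : (fun x => u x - v x - (φ k x - ψ k x)) =
      fun x => (u x - φ k x) - (v x - ψ k x) := by
    ext x
    ring
  have squeeze {f : ℕ → ℝ≥0∞} (hf : ∀ k, f k ≤ w1Norm Ω p (fun x => u x - φ k x) +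
      w1Norm Ω p (fun x => v x - ψ k x)) : Tendsto f atTop (𝓝 0) :=
    tendsto_of_tendsto_of_tendsto_of_le_of_le tendsto_const_nhds (by simpa using hφu.add hψv)
      (fun _ => zero_le) hf
  simp only [regroup]
  refine tendsto_w1Norm_zero hp₀ (squeeze fun k => ?_) (squeeze fun k => ?_)
  · exact (eLpNorm_sub_le (huφ k).1.1 (hvψ k).1.1 (by simpa)).trans
      (add_le_add (eLpNorm_le_w1Norm Ω hp₀ _) (eLpNorm_le_w1Norm Ω hp₀ _))
  · exact ((huφ k).eLpNorm_weakGradient_sub_le hΩ hp (hvψ k)).trans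
      (add_le_add (eLpNorm_weakGradient_le_w1Norm Ω hp₀ _)
        (eLpNorm_weakGradient_le_w1Norm Ω hp₀ _))

end Sobolev

section Poincare

lemma exists_inv_sub_inv_eq_inv {n p : ℝ} (hn : 2 ≤ n) (hp : 2 ≤ p) :
    ∃ q : ℝ, 1 ≤ q ∧ q < n ∧ q ≤ p ∧ q⁻¹ - n⁻¹ = p⁻¹ := by
  refine ⟨n * p / (n + p), ?_, ?_, ?_, ?_⟩
  · rw [le_div_iff₀ (by linarith)]
    nlinarith
  · rw [div_lt_iff₀ (by linarith)]
    nlinarith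
  · rw [div_le_iff₀ (by linarith)]
    nlinarith
  · field_simp
    ring

-- The Gagliardo–Nirenberg–Sobolev inequality is applied with the exponent `q < n` whose Sobolev
-- conjugate is `p`; Hölder's inequality on the bounded support then raises `q` to `p`.
lemma exists_eLpNorm_le_mul_eLpNorm_fderiv {E F : Type*} [NormedAddCommGroup E] [NormedSpace ℝ E]
    [FiniteDimensional ℝ E] [MeasurableSpace E] [BorelSpace E] (ν : Measure E)
    [ν.IsAddHaarMeasure] [NormedAddCommGroup F] [NormedSpace ℝ F] [FiniteDimensional ℝ F]
    (hE : 2 ≤ Module.finrank ℝ E) {p : ℝ} (hp : 2 ≤ p) {s : Set E} (hs : Bornology.IsBounded s) :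
    ∃ C : NNReal, ∀ f : E → F, ContDiff ℝ 1 f → f.support ⊆ s →
      eLpNorm f (ENNReal.ofReal p) ν ≤ C * eLpNorm (fderiv ℝ f) (ENNReal.ofReal p) ν := by
  obtain ⟨q, hq₁, hqn, hqp, conjugate⟩ := exists_inv_sub_inv_eq_inv (Nat.ofNat_le_cast.2 hE) hp
  have hp₀ : 0 < p := by linarith
  have hq₀ : 0 < q := by linarith
  set K : ℝ≥0∞ := ν (closure s) ^ (1 / q - 1 / p)
  have hK : K ≠ ⊤ :=
    ENNReal.rpow_ne_top_of_nonneg (sub_nonneg.2 (one_div_le_one_div_of_le hq₀ hqp))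
      hs.closure.measure_lt_top.ne
  refine ⟨eLpNormLESNormFDerivOfLeConst F ν s q.toNNReal p.toNNReal * K.toNNReal,
    fun f hf hfs => ?_⟩
  have sobolev : eLpNorm f (ENNReal.ofReal p) ν ≤
      eLpNormLESNormFDerivOfLeConst F ν s q.toNNReal p.toNNReal *
        eLpNorm (fderiv ℝ f) (ENNReal.ofReal q) ν := by
    refine eLpNorm_le_eLpNorm_fderiv_of_le ν hf hfs ?_ ?_ ?_ hs
    · rwa [← NNReal.coe_le_coe, Real.coe_toNNReal _ hq₀.le]
    · rwa [← NNReal.coe_lt_coe, Real.coe_toNNReal _ hq₀.le]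
    · rw [NNReal.coe_inv, Real.coe_toNNReal _ hq₀.le, Real.coe_toNNReal _ hp₀.le, conjugate]
  have hölder : eLpNorm (fderiv ℝ f) (ENNReal.ofReal q) ν ≤
      eLpNorm (fderiv ℝ f) (ENNReal.ofReal p) ν * K := by
    have := eLpNorm_le_eLpNorm_mul_of_support_subset (ν := ν)
      ((support_fderiv_subset ℝ (f := f)).trans (closure_mono hfs))
      (hf.continuous_fderiv one_ne_zero).aestronglyMeasurable (ENNReal.ofReal_le_ofReal hqp)
    rwa [ENNReal.toReal_ofReal hq₀.le, ENNReal.toReal_ofReal hp₀.le] at this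
  rw [ENNReal.coe_mul, ENNReal.coe_toNNReal hK, mul_assoc, mul_comm K]
  exact sobolev.trans (by gcongr)

variable {Ω : Set Plane} {p : ℝ}

lemma exists_poincare_isTestFunction (hΩ : Bornology.IsBounded Ω) (hp : 2 ≤ p) :
    ∃ C : NNReal, ∀ φ : Plane → ℝ, IsTestFunction Ω φ →
      eLpNorm φ (ENNReal.ofReal p) (volume.restrict Ω) ≤
        C * eLpNorm (gradient φ) (ENNReal.ofReal p) (volume.restrict Ω) := by
  obtain ⟨C, hC⟩ := exists_eLpNorm_le_mul_eLpNorm_fderiv (F := ℝ) (volume : Measure Plane)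
    (by simp) hp hΩ
  refine ⟨C, fun φ hφ => ?_⟩
  rw [eLpNorm_restrict_eq_of_support_subset hφ.support_subset,
    eLpNorm_restrict_eq_of_support_subset ((subset_tsupport _).trans hφ.tsupport_gradient_subset),
    eLpNorm_congr_norm_ae (ae_of_all _ (norm_gradient φ))]
  exact hC φ (hφ.1.of_le (by simp)) hφ.support_subset

theorem exists_poincare_eLpNorm (hΩ : IsOpen Ω) (hΩb : Bornology.IsBounded Ω) (hp : 2 ≤ p) :
    ∃ C : NNReal, ∀ u : Plane → ℝ, MemW10 Ω p u →
      eLpNorm u (ENNReal.ofReal p) (volume.restrict Ω) ≤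
        C * eLpNorm (weakGradient Ω u) (ENNReal.ofReal p) (volume.restrict Ω) := by
  have hp₀ : 0 < p := by linarith
  have hp₁ : 1 ≤ p := by linarith
  have hp₁' : 1 ≤ ENNReal.ofReal p := by simpa
  obtain ⟨C, hC⟩ := exists_poincare_isTestFunction hΩb hp
  refine ⟨C, fun u ⟨hu, φ, hφ, hφu⟩ => ?_⟩
  set δ : ℕ → ℝ≥0∞ := fun k => w1Norm Ω p fun x => u x - φ k x
  set I : ℝ≥0∞ := eLpNorm (weakGradient Ω u) (ENNReal.ofReal p) (volume.restrict Ω)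
  have hlim : Tendsto (fun k => δ k + C * (I + δ k)) atTop (𝓝 (0 + C * (I + 0))) :=
    hφu.add (ENNReal.Tendsto.const_mul (tendsto_const_nhds.add hφu) (.inr ENNReal.coe_ne_top))
  rw [zero_add, add_zero] at hlim
  refine ge_of_tendsto' hlim fun k => ?_
  have hφk := (hφ k).memW1 p
  have hδ := hu.sub hΩ hφk
  have function_le : eLpNorm u (ENNReal.ofReal p) (volume.restrict Ω) ≤
      δ k + eLpNorm (φ k) (ENNReal.ofReal p) (volume.restrict Ω) := by
    calc _ = eLpNorm ((fun x => u x - φ k x) + φ k) (ENNReal.ofReal p) (volume.restrict Ω) := by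
          congr
          ext x
          simp
      _ ≤ _ := (eLpNorm_add_le hδ.1.1 hφk.1.1 hp₁').trans
        (by gcongr; exact eLpNorm_le_w1Norm Ω hp₀ _)
  have gradient_le : eLpNorm (gradient (φ k)) (ENNReal.ofReal p) (volume.restrict Ω) ≤
      I + δ k := by
    have hφ_eq : gradient (φ k) =ᵐ[volume.restrict Ω]
        weakGradient Ω fun x => u x - (u x - φ k x) := by
      simp only [sub_sub_cancel]
      exact ((hφ k).hasWeakGradient.weakGradient_ae_eq hΩ).symm
    rw [eLpNorm_congr_ae hφ_eq]
    exact (hu.eLpNorm_weakGradient_sub_le hΩ hp₁ hδ).trans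
      (by gcongr; exact eLpNorm_weakGradient_le_w1Norm Ω hp₀ _)
  calc _ ≤ δ k + eLpNorm (φ k) (ENNReal.ofReal p) (volume.restrict Ω) := function_le
    _ ≤ δ k + C * eLpNorm (gradient (φ k)) (ENNReal.ofReal p) (volume.restrict Ω) := by
      gcongr; exact hC _ (hφ k)
    _ ≤ δ k + C * (I + δ k) := by gcongr

theorem exists_poincare (hΩ : IsOpen Ω) (hΩb : Bornology.IsBounded Ω) (hp : 2 ≤ p) :
    ∃ C : ℝ, 0 ≤ C ∧ ∀ u : Plane → ℝ, MemW10 Ω p u →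
      ∫ x in Ω, |u x| ^ p ≤ C * ∫ x in Ω, ‖weakGradient Ω u x‖ ^ p := by
  have hp₀ : 0 < p := by linarith
  obtain ⟨C, hC⟩ := exists_poincare_eLpNorm hΩ hΩb hp
  have hCp : (0 : ℝ) ≤ (C : ℝ) ^ p := by positivity
  refine ⟨(C : ℝ) ^ p, hCp, fun u hu => ?_⟩
  have hG : 0 ≤ ∫ x in Ω, ‖weakGradient Ω u x‖ ^ p := integral_nonneg fun x => by positivity
  have h := ENNReal.rpow_le_rpow (hC u hu) hp₀.le
  rw [ENNReal.mul_rpow_of_nonneg _ _ hp₀.le, eLpNorm_ofReal_rpow_eq hp₀ hu.1.1,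
    eLpNorm_ofReal_rpow_eq hp₀ (hu.1.memLp_weakGradient hΩ), ← ENNReal.ofReal_coe_nnreal,
    ENNReal.ofReal_rpow_of_nonneg (by positivity) hp₀.le, ← ENNReal.ofReal_mul hCp] at h
  exact (ENNReal.ofReal_le_ofReal_iff (mul_nonneg hCp hG)).1 h

end Poincare

/-! ### Averages over time steps -/

section Time

variable {X : Type*} [NormedAddCommGroup X]

lemma exists_Icc_of_isCompact {K : Set ℝ} {a b : ℝ} (hK : IsCompact K) (hab : a < b)
    (hsub : K ⊆ Set.Ioo a b) : ∃ c d, a < c ∧ d < b ∧ K ⊆ Set.Icc c d := by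
  rcases K.eq_empty_or_nonempty with rfl | hne
  · obtain ⟨m, ham, hmb⟩ := exists_between hab
    exact ⟨m, m, ham, hmb, Set.empty_subset _⟩
  · exact ⟨sInf K, sSup K, (hsub (hK.sInf_mem hne)).1, (hsub (hK.sSup_mem hne)).2, fun x hx =>
      ⟨csInf_le hK.bddBelow hx, le_csSup hK.bddAbove hx⟩⟩

lemma integral_eq_zero_of_notMem_Icc {ψ : ℝ → ℝ} {c d t : ℝ} (hψ : ∀ s ∉ Set.Icc c d, ψ s = 0)
    (hmean : ∫ s, ψ s = 0) (ht : t ∉ Set.Icc c d) : ∫ s in c..t, ψ s = 0 := by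
  rcases lt_or_ge t c with htc | hct
  · rw [intervalIntegral.integral_of_ge htc.le, integral_Ioc_eq_integral_Ioo, neg_eq_zero]
    exact setIntegral_eq_zero_of_forall_eq_zero fun s hs => hψ s fun h => hs.2.not_ge h.1
  · have hdt : d < t := not_le.1 fun h => ht ⟨hct, h⟩
    rw [intervalIntegral.integral_of_le hct, ← integral_Icc_eq_integral_Ioc, ← hmean]
    exact setIntegral_eq_integral_of_forall_compl_eq_zero fun s hs =>
      hψ s fun h => hs ⟨h.1, h.2.trans hdt.le⟩

lemma exists_deriv_eq_of_integral_eq_zero {a b : ℝ} (hab : a < b) {ψ : ℝ → ℝ}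
    (hψ : ContDiff ℝ ∞ ψ) (hψc : HasCompactSupport ψ) (hψs : tsupport ψ ⊆ Set.Ioo a b)
    (hmean : ∫ t, ψ t = 0) : ∃ Ψ : ℝ → ℝ, ContDiff ℝ ∞ Ψ ∧ HasCompactSupport Ψ ∧
      tsupport Ψ ⊆ Set.Ioo a b ∧ deriv Ψ = ψ := by
  obtain ⟨c, d, hac, hdb, hcd⟩ := exists_Icc_of_isCompact hψc hab hψs
  have hψ0 : ∀ t ∉ Set.Icc c d, ψ t = 0 := fun t ht =>
    image_eq_zero_of_notMem_tsupport fun h => ht (hcd h)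
  have hderiv (t : ℝ) : HasDerivAt (fun t => ∫ s in c..t, ψ s) (ψ t) t :=
    intervalIntegral.integral_hasDerivAt_right (hψ.continuous.intervalIntegrable _ _)
      hψ.continuous.stronglyMeasurable.stronglyMeasurableAtFilter hψ.continuous.continuousAt
  have hsupp : tsupport (fun t => ∫ s in c..t, ψ s) ⊆ Set.Icc c d :=
    closure_minimal (fun t ht => by_contra fun h =>
      ht (integral_eq_zero_of_notMem_Icc hψ0 hmean h)) isClosed_Icc
  have hderiv_eq : deriv (fun t => ∫ s in c..t, ψ s) = ψ := funext fun t => (hderiv t).deriv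
  refine ⟨fun t => ∫ s in c..t, ψ s, ?_, .of_support_subset_isCompact isCompact_Icc
    (subset_closure.trans hsupp), hsupp.trans (Set.Icc_subset_Ioo hac hdb), hderiv_eq⟩
  rw [contDiff_infty_iff_deriv, hderiv_eq]
  exact ⟨fun t => (hderiv t).differentiableAt, hψ⟩

lemma exists_contDiff_tsupport_subset_Ioo_integral_eq_one {a b : ℝ} (hab : a < b) :
    ∃ φ : ℝ → ℝ, ContDiff ℝ ∞ φ ∧ HasCompactSupport φ ∧ tsupport φ ⊆ Set.Ioo a b ∧
      ∫ t, φ t = 1 := by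
  let B : ContDiffBump ((a + b) / 2) := ⟨(b - a) / 8, (b - a) / 4, by linarith, by linarith⟩
  refine ⟨B.normed volume, B.contDiff_normed, B.hasCompactSupport_normed, ?_, B.integral_normed⟩
  rw [B.tsupport_normed_eq, Real.closedBall_eq_Icc]
  change Set.Icc ((a + b) / 2 - (b - a) / 4) ((a + b) / 2 + (b - a) / 4) ⊆ _
  exact Set.Icc_subset_Ioo (by linarith) (by linarith)

variable [NormedSpace ℝ X]

lemma setIntegral_smul_eq_integral {s : Set ℝ} {φ : ℝ → ℝ} (hφ : tsupport φ ⊆ s) (w : ℝ → X) :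
    ∫ t in s, φ t • w t = ∫ t, φ t • w t :=
  setIntegral_eq_integral_of_forall_compl_eq_zero fun t ht => by
    rw [image_eq_zero_of_notMem_tsupport fun h => ht (hφ h), zero_smul]

-- The du Bois-Reymond lemma: subtracting a fixed bump from `φ` gives the derivative of a test
-- function, hence `∫ φ w = (∫ φ) c` with `c` the integral of `w` against the bump.
lemma ae_eq_const_of_integral_deriv_smul_eq_zero [CompleteSpace X] {a b : ℝ} (hab : a < b)
    {w : ℝ → X} (hw : IntegrableOn w (Set.Ioo a b))
    (h : ∀ φ : ℝ → ℝ, ContDiff ℝ ∞ φ → HasCompactSupport φ → tsupport φ ⊆ Set.Ioo a b →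
      ∫ t in Set.Ioo a b, deriv φ t • w t = 0) :
    ∃ c : X, ∀ᵐ t ∂volume.restrict (Set.Ioo a b), w t = c := by
  obtain ⟨φ₀, hφ₀, hφ₀c, hφ₀s, hφ₀1⟩ := exists_contDiff_tsupport_subset_Ioo_integral_eq_one hab
  set c : X := ∫ t in Set.Ioo a b, φ₀ t • w t
  have hconst : IntegrableOn (fun _ => c) (Set.Ioo a b) := integrableOn_const (by simp)
  have hzero := isOpen_Ioo.ae_eq_zero_of_integral_contDiff_smul_eq_zero (μ := volume)
    (f := fun t => w t - c) (U := Set.Ioo a b) (hw.sub hconst).locallyIntegrableOn ?_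
  · refine ⟨c, ?_⟩
    rw [ae_restrict_iff' measurableSet_Ioo]
    filter_upwards [hzero] with t ht htm using sub_eq_zero.1 (ht htm)
  intro φ hφ hφc hφs
  set m : ℝ := ∫ t, φ t
  have hmean : ∫ t, (φ t - m * φ₀ t) = 0 := by
    rw [integral_sub (hφ.continuous.integrable_of_hasCompactSupport hφc)
      ((hφ₀.continuous.integrable_of_hasCompactSupport hφ₀c).const_mul _), integral_const_mul,
      hφ₀1, mul_one, sub_self]
  obtain ⟨Ψ, hΨ, hΨc, hΨs, hΨφ⟩ := exists_deriv_eq_of_integral_eq_zero hab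
    (hφ.sub (contDiff_const.mul hφ₀)) (hφc.sub hφ₀c.mul_left) ((tsupport_sub _ _).trans
      (Set.union_subset hφs ((tsupport_mul_subset_right).trans hφ₀s))) hmean
  have hφw := integrableOn_smul_of_hasCompactSupport_left hφ.continuous hφc hφs
    hw.locallyIntegrableOn
  have hφ₀w : IntegrableOn (fun t => m • φ₀ t • w t) (Set.Ioo a b) :=
    (integrableOn_smul_of_hasCompactSupport_left hφ₀.continuous hφ₀c hφ₀s
      hw.locallyIntegrableOn).smul m
  have hφw_eq : ∫ t in Set.Ioo a b, φ t • w t = m • c := by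
    rw [← sub_eq_zero, ← h Ψ hΨ hΨc hΨs, hΨφ, ← integral_smul,
      ← integral_sub hφw hφ₀w]
    simp only [sub_smul, smul_smul]
  have hφc_eq : ∫ t in Set.Ioo a b, φ t • c = m • c := by
    rw [setIntegral_smul_eq_integral hφs, integral_smul_const]
  calc ∫ t, φ t • (w t - c) = ∫ t in Set.Ioo a b, φ t • (w t - c) :=
        (setIntegral_smul_eq_integral hφs _).symm
    _ = ∫ t in Set.Ioo a b, (φ t • w t - φ t • c) :=
        integral_congr_ae (ae_of_all _ fun t => smul_sub (φ t) (w t) c)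
    _ = 0 := by
        rw [integral_sub hφw (integrableOn_smul_of_hasCompactSupport_left hφ.continuous hφc hφs
          hconst.locallyIntegrableOn), hφw_eq, hφc_eq, sub_self]

lemma continuous_setIntegral_Iic {g : ℝ → X} (hg : Integrable g) :
    Continuous fun t => ∫ s in Set.Iic t, g s := by
  have heq (t : ℝ) : ∫ s in Set.Iic t, g s = (∫ s in Set.Iic 0, g s) + ∫ s in (0 : ℝ)..t, g s := by
    rw [← intervalIntegral.integral_Iic_sub_Iic hg.integrableOn hg.integrableOn,
      add_sub_cancel]
  rw [funext heq]
  exact continuous_const.add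
    (intervalIntegral.continuous_primitive (fun _ _ => hg.intervalIntegrable) 0)

lemma norm_setIntegral_Iic_sub_le {g : ℝ → X} (hg : Integrable g) {s t : ℝ} (hst : s ≤ t) :
    ‖(∫ r in Set.Iic t, g r) - ∫ r in Set.Iic s, g r‖ ≤
      (∫ r in Set.Iic t, ‖g r‖) - ∫ r in Set.Iic s, ‖g r‖ := by
  have hsub : Set.Iic s ⊆ Set.Iic t := Set.Iic_subset_Iic.2 hst
  rw [← setIntegral_sdiff measurableSet_Iic hg.integrableOn hsub,
    ← setIntegral_sdiff measurableSet_Iic hg.norm.integrableOn hsub]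
  exact norm_integral_le_integral_norm _

lemma integral_deriv_smul_setIntegral_Iic [CompleteSpace X] {φ : ℝ → ℝ} {g : ℝ → X}
    (hφ : ContDiff ℝ 1 φ) (hφc : HasCompactSupport φ) (hg : Integrable g) :
    ∫ t, deriv φ t • ∫ s in Set.Iic t, g s = -∫ s, φ s • g s := by
  have hderiv : Integrable (deriv φ) :=
    (hφ.continuous_deriv le_rfl).integrable_of_hasCompactSupport hφc.deriv
  have hint : Integrable (fun z : ℝ × ℝ => (Set.Iic z.1).indicator
      (fun s => deriv φ z.1 • g s) z.2) (volume.prod volume) := by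
    refine ((hderiv.smul_prod hg).indicator
      (measurableSet_le measurable_snd measurable_fst)).congr (ae_of_all _ fun z => ?_)
    simp [Set.indicator]
  have hswap (s t : ℝ) : (Set.Iic t).indicator (fun s => deriv φ t • g s) s =
      (Set.Ici s).indicator (fun t => deriv φ t • g s) t := by
    simp [Set.indicator]
  calc ∫ t, deriv φ t • ∫ s in Set.Iic t, g s
      = ∫ t, ∫ s, (Set.Iic t).indicator (fun s => deriv φ t • g s) s := by
        simp only [integral_indicator measurableSet_Iic, integral_smul]
    _ = ∫ s, ∫ t, (Set.Ici s).indicator (fun t => deriv φ t • g s) t := by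
        rw [integral_integral_swap hint]
        simp only [hswap]
    _ = ∫ s, -(φ s • g s) := by
        simp only [integral_indicator measurableSet_Ici, integral_smul_const,
          integral_Ici_eq_integral_Ioi, hφc.integral_Ioi_deriv_eq hφ, neg_smul]
    _ = -∫ s, φ s • g s := integral_neg _

lemma MemW1Time.integrableOn {T p : ℝ} {a : ℝ → X} (ha : MemW1Time T p a) (hp : 1 ≤ p) :
    IntegrableOn a (Set.Ioo 0 T) :=
  ha.1.integrable (by simpa using hp)

lemma MemW1Time.exists_primitive [CompleteSpace X] {T p : ℝ} {a : ℝ → X} (ha : MemW1Time T p a)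
    (hT : 0 < T) (hp : 1 ≤ p) : ∃ (c : X) (g : ℝ → X), Integrable g ∧
      ∀ᵐ t ∂volume.restrict (Set.Ioo 0 T), a t = c + ∫ s in Set.Iic t, g s := by
  have haint := ha.integrableOn hp
  obtain ⟨-, a', ha', hweak⟩ := ha
  set g : ℝ → X := (Set.Ioo 0 T).indicator a'
  have hg : Integrable g :=
    (integrable_indicator_iff measurableSet_Ioo).2 (ha'.integrable (by simpa using hp))
  have hprim : IntegrableOn (fun t => ∫ s in Set.Iic t, g s) (Set.Ioo 0 T) :=
    ((continuous_setIntegral_Iic hg).integrableOn_Icc).mono_set Set.Ioo_subset_Icc_self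
  obtain ⟨c, hc⟩ := ae_eq_const_of_integral_deriv_smul_eq_zero hT (haint.sub hprim)
    fun φ hφ hφc hφs => by
      have hφs' : tsupport (deriv φ) ⊆ Set.Ioo 0 T := tsupport_deriv_subset.trans hφs
      have hsmul {f : ℝ → X} (hf : IntegrableOn f (Set.Ioo 0 T)) :
          IntegrableOn (fun t => deriv φ t • f t) (Set.Ioo 0 T) :=
        integrableOn_smul_of_hasCompactSupport_left (hφ.continuous_deriv (by simp)) hφc.deriv hφs'
          hf.locallyIntegrableOn
      have hφg : ∫ t in Set.Ioo 0 T, φ t • a' t = ∫ t, φ t • g t := by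
        rw [← integral_indicator measurableSet_Ioo]
        simp only [g, Set.indicator_smul_apply]
      simp only [Pi.sub_apply, smul_sub]
      rw [integral_sub (hsmul haint) (hsmul hprim), hweak φ hφ hφc hφs,
        setIntegral_smul_eq_integral hφs',
          integral_deriv_smul_setIntegral_Iic (hφ.of_le (by simp)) hφc hg, hφg, sub_self]
  exact ⟨c, g, hg, hc.mono fun t ht => sub_eq_iff_eq_add.1 ht⟩

/-- The mean of `f` over the `n`-th cell `(n l, (n + 1) l)` of the uniform time grid. -/
def cellAverage (l : ℝ) (f : ℝ → X) (n : ℕ) : X :=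
  (1 / l) • ∫ t in (n * l)..((n + 1) * l), f t

lemma cellAverage_eq_integral_add (l : ℝ) (f : ℝ → X) (n : ℕ) :
    cellAverage l f n = (1 / l) • ∫ s in (0 : ℝ)..l, f (n * l + s) := by
  rw [cellAverage, intervalIntegral.integral_comp_add_left, add_zero, add_one_mul]

lemma cellAverage_congr_ae {l : ℝ} (hl : 0 ≤ l) {f g : ℝ → X} {N n : ℕ} (hn : n < N)
    (hfg : f =ᵐ[volume.restrict (Set.Ioo 0 (N * l))] g) :
    cellAverage l f n = cellAverage l g n := by
  have hsub : Set.Ioo (n * l) ((n + 1) * l) ⊆ Set.Ioo 0 (N * l) := by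
    have hnN : (n : ℝ) + 1 ≤ N := by exact_mod_cast hn
    exact Set.Ioo_subset_Ioo (by positivity) (by gcongr)
  have hle : n * l ≤ (n + 1) * l := by linarith
  rw [cellAverage, cellAverage, intervalIntegral.integral_of_le hle,
    intervalIntegral.integral_of_le hle, integral_Ioc_eq_integral_Ioo,
    integral_Ioc_eq_integral_Ioo]
  congr 1
  exact integral_congr_ae (ae_restrict_of_ae_restrict_of_subset hsub hfg)

lemma norm_cellAverage_le {l K : ℝ} (hl : 0 < l) {f : ℝ → X} (hf : ∀ t, ‖f t‖ ≤ K) (n : ℕ) :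
    ‖cellAverage l f n‖ ≤ K := by
  have hint := intervalIntegral.norm_integral_le_of_norm_le_const (a := 0) (b := l)
    (f := fun s => f (n * l + s)) (C := K) fun s _ => hf _
  rw [sub_zero, abs_of_pos hl] at hint
  rw [cellAverage_eq_integral_add, norm_smul, Real.norm_of_nonneg (by positivity)]
  calc 1 / l * ‖∫ s in (0 : ℝ)..l, f (n * l + s)‖ ≤ 1 / l * (K * l) := by gcongr
    _ = K := by field_simp

lemma norm_cellAverage_succ_sub_le {l : ℝ} (hl : 0 < l) {f : ℝ → X} {V : ℝ → ℝ}
    (hf : Continuous f) (hfV : ∀ s t, s ≤ t → ‖f t - f s‖ ≤ V t - V s) (n : ℕ) :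
    ‖cellAverage l f (n + 1) - cellAverage l f n‖ ≤
      cellAverage l V (n + 1) - cellAverage l V n := by
  have hV : Monotone V := fun s t hst => by linarith [hfV s t hst, norm_nonneg (f t - f s)]
  have hfint (c : ℝ) : IntervalIntegrable (fun s => f (c + s)) volume 0 l :=
    (hf.comp (continuous_const_add c)).intervalIntegrable _ _
  have hVint (c : ℝ) : IntervalIntegrable (fun s => V (c + s)) volume 0 l :=
    Monotone.intervalIntegrable fun _ _ h => hV (by gcongr)
  simp only [cellAverage_eq_integral_add]
  rw [← smul_sub, ← smul_sub, ← intervalIntegral.integral_sub (hfint _) (hfint _),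
    ← intervalIntegral.integral_sub (hVint _) (hVint _), norm_smul,
    Real.norm_of_nonneg (by positivity), smul_eq_mul]
  gcongr
  refine intervalIntegral.norm_integral_le_of_norm_le hl.le (ae_of_all _ fun s _ => hfV _ _ ?_)
    ((hVint _).sub (hVint _))
  gcongr
  simp

lemma sum_norm_cellAverage_succ_sub_le {l W : ℝ} (hl : 0 < l) {f : ℝ → X} {V : ℝ → ℝ}
    (hf : Continuous f) (hfV : ∀ s t, s ≤ t → ‖f t - f s‖ ≤ V t - V s)
    (hV : ∀ t, |V t| ≤ W) (m : ℕ) :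
    ∑ n ∈ Finset.range m, ‖cellAverage l f (n + 1) - cellAverage l f n‖ ≤ 2 * W :=
  calc _ ≤ ∑ n ∈ Finset.range m, (cellAverage l V (n + 1) - cellAverage l V n) :=
        Finset.sum_le_sum fun n _ => norm_cellAverage_succ_sub_le hl hf hfV n
    _ = cellAverage l V m - cellAverage l V 0 := Finset.sum_range_sub _ m
    _ ≤ 2 * W := by
        have hbound (n : ℕ) : |cellAverage l V n| ≤ W :=
          norm_cellAverage_le (X := ℝ) hl hV n
        linarith [(abs_le.1 (hbound m)).2, (abs_le.1 (hbound 0)).1]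

lemma step_pos {T : ℝ} (hT : 0 < T) {N : ℕ} (hN : 1 ≤ N) : 0 < step T N :=
  div_pos hT (by exact_mod_cast hN)

lemma MemW1Time.exists_cellAverage_bound [CompleteSpace X] {T p : ℝ} {a : ℝ → X}
    (ha : MemW1Time T p a) (hT : 0 < T) (hp : 1 ≤ p) : ∃ K : ℝ, 0 < K ∧ ∀ N : ℕ, 1 ≤ N →
      (∀ n < N, ‖cellAverage (step T N) a n‖ ≤ K) ∧
      ∑ n ∈ Finset.range (N - 1),
        ‖cellAverage (step T N) a (n + 1) - cellAverage (step T N) a n‖ ≤ K := by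
  obtain ⟨c, g, hg, hag⟩ := ha.exists_primitive hT hp
  set W : ℝ := ∫ s, ‖g s‖
  set b : ℝ → X := fun t => c + ∫ s in Set.Iic t, g s
  have hW : 0 ≤ W := integral_nonneg fun _ => norm_nonneg _
  have hV (t : ℝ) : ∫ s in Set.Iic t, ‖g s‖ ≤ W :=
    setIntegral_le_integral hg.norm (ae_of_all _ fun _ => norm_nonneg _)
  have hb (t : ℝ) : ‖b t‖ ≤ ‖c‖ + W := (norm_add_le _ _).trans
    (add_le_add_right ((norm_integral_le_integral_norm _).trans (hV t)) _)
  refine ⟨‖c‖ + 2 * W + 1, by positivity, fun N hN => ?_⟩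
  have hl : 0 < step T N := step_pos hT hN
  have hlN : N * step T N = T := mul_div_cancel₀ T (Nat.cast_ne_zero.2 (by lia))
  have havg : ∀ n < N, cellAverage (step T N) a n = cellAverage (step T N) b n :=
    fun n hn => cellAverage_congr_ae hl.le hn (hlN.symm ▸ hag)
  refine ⟨fun n hn => ?_, ?_⟩
  · rw [havg n hn]
    linarith [norm_cellAverage_le hl hb n]
  · have hsum_congr : ∑ n ∈ Finset.range (N - 1),
        ‖cellAverage (step T N) a (n + 1) - cellAverage (step T N) a n‖ =
        ∑ n ∈ Finset.range (N - 1),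
          ‖cellAverage (step T N) b (n + 1) - cellAverage (step T N) b n‖ :=
      Finset.sum_congr rfl fun n hn => by
        rw [Finset.mem_range] at hn
        rw [havg n (by lia), havg (n + 1) (by lia)]
    have hsum := sum_norm_cellAverage_succ_sub_le hl (f := b) (W := W)
      (V := fun t => ∫ s in Set.Iic t, ‖g s‖) (continuous_const.add (continuous_setIntegral_Iic hg))
      (fun s t hst => by simpa only [b, add_sub_add_left_eq_sub] using
        norm_setIntegral_Iic_sub_le hg hst)
      (fun t => (abs_of_nonneg (integral_nonneg fun _ => norm_nonneg _)).trans_le (hV t)) (N - 1)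
    linarith [norm_nonneg c]

end Time

/-! ### The energy inequality of one step -/

section Integrability

variable {X : Type*} [MeasurableSpace X] {ν : Measure X}

lemma integrable_mul_of_ae_bounds {m f : X → ℝ} {m₁ m₂ : ℝ} (hm : AEMeasurable m ν)
    (hmb : ∀ᵐ x ∂ν, m₁ ≤ m x ∧ m x ≤ m₂) (hf : Integrable f ν) :
    Integrable (fun x => m x * f x) ν :=
  hf.bdd_mul hm.aestronglyMeasurable (c := max |m₁| |m₂|)
    (hmb.mono fun _ hx => abs_le_max_abs_abs hx.1 hx.2)

lemma integrable_oddPow_mul {α : ℝ} (hα : 1 < α) {u v : X → ℝ}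
    (hu : MemLp u (ENNReal.ofReal α) ν) (hv : MemLp v (ENNReal.ofReal α) ν) :
    Integrable (fun x => oddPow (α - 2) (u x) * v x) ν := by
  have hconj := (Real.HolderConjugate.conjExponent hα).symm
  have := hconj.ennrealOfReal
  refine MemLp.integrable_mul (p := ENNReal.ofReal α.conjExponent) ?_ hv
  refine memLp_oddPow (by linarith) hconj.nonneg ?_
  rwa [show α - 2 + 1 = α - 1 by ring, Real.conjExponent, div_mul_cancel₀ _ (by linarith)]

lemma memLp_negPart {q : ℝ≥0∞} {u : X → ℝ} (hu : MemLp u q ν) :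
    MemLp (fun x => negPart (u x)) q ν :=
  hu.of_le (measurable_negPart.comp_aemeasurable hu.1.aemeasurable).aestronglyMeasurable
    (ae_of_all _ fun x => by
      rw [Real.norm_of_nonneg (negPart_nonneg _)]
      exact negPart_le_abs _)

lemma integrable_rpow_norm_mul_inner {E : Type*} [NormedAddCommGroup E] [InnerProductSpace ℝ E]
    {p : ℝ} (hp : 1 < p) {G H : X → E} (hG : MemLp G (ENNReal.ofReal p) ν)
    (hH : MemLp H (ENNReal.ofReal p) ν) :
    Integrable (fun x => ‖G x‖ ^ (p - 2) * inner ℝ (G x) (H x)) ν :=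
  ((integrable_norm_rpow_of_memLp_ofReal (by linarith) hG).add
    (integrable_norm_rpow_of_memLp_ofReal (by linarith) hH)).mono'
    ((hG.1.norm.aemeasurable.pow_const _).mul (hG.1.inner hH.1).aemeasurable).aestronglyMeasurable
    (ae_of_all _ fun x => abs_rpow_mul_inner_le hp (G x) (H x))

end Integrability

section Functionals

variable {Ω : Set Plane}

/-- The functional on functions on `Ω` defined by a continuous function `f` on the closure. -/
def pairing (f : closure Ω →ᵇ ℝ) (v : Plane → ℝ) : ℝ :=
  ∫ x in Ω, extendZero f x * v x

lemma abs_extendZero_le (f : closure Ω →ᵇ ℝ) (x : Plane) : |extendZero f x| ≤ ‖f‖ := by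
  unfold extendZero
  split_ifs with h
  · exact f.norm_coe_le_norm _
  · simp

lemma extendZero_sub (f g : closure Ω →ᵇ ℝ) (x : Plane) :
    extendZero (f - g) x = extendZero f x - extendZero g x := by
  unfold extendZero
  split_ifs with h <;> simp

lemma aestronglyMeasurable_extendZero (f : closure Ω →ᵇ ℝ) :
    AEStronglyMeasurable (extendZero f) (volume.restrict Ω) := by
  have hcont : ContinuousOn (extendZero f) (closure Ω) := by
    rw [continuousOn_iff_continuous_domRestrict]
    exact f.continuous.congr fun x => by simp [extendZero]
  exact (hcont.aestronglyMeasurable isClosed_closure.measurableSet).mono_measure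
    (Measure.restrict_mono subset_closure le_rfl)

lemma integrable_extendZero_mul (f : closure Ω →ᵇ ℝ) {v : Plane → ℝ}
    (hv : Integrable v (volume.restrict Ω)) :
    Integrable (fun x => extendZero f x * v x) (volume.restrict Ω) :=
  hv.bdd_mul (aestronglyMeasurable_extendZero f) (ae_of_all _ (abs_extendZero_le f))

lemma pairing_sub_left (f g : closure Ω →ᵇ ℝ) {v : Plane → ℝ}
    (hv : Integrable v (volume.restrict Ω)) :
    pairing (f - g) v = pairing f v - pairing g v := by
  simp only [pairing, extendZero_sub, sub_mul]
  exact integral_sub (integrable_extendZero_mul f hv) (integrable_extendZero_mul g hv)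

lemma pairing_sub_right (f : closure Ω →ᵇ ℝ) {u v : Plane → ℝ}
    (hu : Integrable u (volume.restrict Ω)) (hv : Integrable v (volume.restrict Ω)) :
    pairing f (fun x => u x - v x) = pairing f u - pairing f v := by
  simp only [pairing, mul_sub]
  exact integral_sub (integrable_extendZero_mul f hu) (integrable_extendZero_mul f hv)

lemma abs_pairing_le (f : closure Ω →ᵇ ℝ) {v : Plane → ℝ}
    (hv : Integrable v (volume.restrict Ω)) : |pairing f v| ≤ ‖f‖ * ∫ x in Ω, |v x| := by
  rw [pairing, ← integral_const_mul, ← Real.norm_eq_abs]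
  refine norm_integral_le_of_norm_le (hv.abs.const_mul _) (ae_of_all _ fun x => ?_)
  rw [Real.norm_eq_abs, abs_mul]
  gcongr
  exact abs_extendZero_le f x

/-- `μ` is a measurable coefficient on `Ω` with `0 < μ₁ ≤ μ ≤ μ₂` almost everywhere. -/
structure IsEllipticCoefficient (Ω : Set Plane) (μ₁ μ₂ : ℝ) (μ : Plane → ℝ) : Prop where
  aemeasurable : AEMeasurable μ (volume.restrict Ω)
  pos : 0 < μ₁
  ae_bounds : ∀ᵐ x ∂volume.restrict Ω, μ₁ ≤ μ x ∧ μ x ≤ μ₂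

/-- The weak form of the weighted `p`-Laplacian `-∇ · (μ |∇v| ^ (p - 2) ∇v)`, tested with `w`. -/
def pLaplacian (Ω : Set Plane) (p : ℝ) (μ : Plane → ℝ) (v w : Plane → ℝ) : ℝ :=
  ∫ x in Ω, μ x * (‖weakGradient Ω v x‖ ^ (p - 2) *
    inner ℝ (weakGradient Ω v x) (weakGradient Ω w x))

/-- The weighted Dirichlet energy; divided by `p`, it is the convex potential of `pLaplacian`. -/
def weightedEnergy (Ω : Set Plane) (p : ℝ) (μ u : Plane → ℝ) : ℝ :=
  ∫ x in Ω, μ x * ‖weakGradient Ω u x‖ ^ p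

/-- The squared `L²` distance of the half powers `|v| ^ ((α - 2) / 2) v` and
`|u| ^ ((α - 2) / 2) u`, which a time step from `u` to `v` dissipates. -/
def dissipation (Ω : Set Plane) (α : ℝ) (u v : Plane → ℝ) : ℝ :=
  ∫ x in Ω, (oddPow ((α - 2) / 2) (v x) - oddPow ((α - 2) / 2) (u x)) ^ 2

/-- The squared `L²` norm of the negative part, by which the constraint `0 ≤ u` is penalized. -/
def penaltyEnergy (Ω : Set Plane) (u : Plane → ℝ) : ℝ :=
  ∫ x in Ω, negPart (u x) ^ 2

/-- `v` is obtained from `u` by one implicit step of length `l` of the penalized scheme with right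
hand side `f`, in `W^{-1,p'}(Ω)`. -/
def IsImplicitStep (Ω : Set Plane) (p α : ℝ) (μ : Plane → ℝ) (κ l : ℝ) (f : closure Ω →ᵇ ℝ)
    (u v : Plane → ℝ) : Prop :=
  ∀ w, MemW10 Ω p w →
    1 / l * (∫ x in Ω, (oddPow (α - 2) (v x) - oddPow (α - 2) (u x)) * w x)
      + pLaplacian Ω p μ v w - 1 / κ * (∫ x in Ω, negPart (v x) * w x) = pairing f w

/-- `u 0, …, u N` are related by implicit steps with the right hand sides `f 0, …, f (N - 1)`. -/
structure IsImplicitScheme (Ω : Set Plane) (p α : ℝ) (μ : Plane → ℝ) (κ l : ℝ)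
    (f : ℕ → closure Ω →ᵇ ℝ) (N : ℕ) (u : ℕ → Plane → ℝ) : Prop where
  memW10 : ∀ n ≤ N, MemW10 Ω p (u n)
  isImplicitStep : ∀ n < N, IsImplicitStep Ω p α μ κ l (f n) (u n) (u (n + 1))

lemma IsSemiDiscreteSolution.isImplicitScheme {p T κ : ℝ} {μ u₀ : Plane → ℝ}
    {a : ℝ → closure Ω →ᵇ ℝ} {N : ℕ} {u : ℕ → Plane → ℝ}
    (hu : IsSemiDiscreteSolution Ω p T μ a u₀ κ N u) :
    IsImplicitScheme Ω p (alpha p) μ κ (step T N) (cellAverage (step T N) a) N u :=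
  ⟨hu.2.1, hu.2.2⟩

variable {p μ₁ μ₂ : ℝ} {μ u v w : Plane → ℝ}

lemma MemW1.integrable_norm_weakGradient_rpow (hΩ : IsOpen Ω) (hp : 0 < p) (hu : MemW1 Ω p u) :
    Integrable (fun x => ‖weakGradient Ω u x‖ ^ p) (volume.restrict Ω) :=
  integrable_norm_rpow_of_memLp_ofReal hp (hu.memLp_weakGradient hΩ)

lemma MemW1.memLp [IsFiniteMeasure (volume.restrict Ω)] {q : ℝ} (hqp : q ≤ p)
    (hu : MemW1 Ω p u) : MemLp u (ENNReal.ofReal q) (volume.restrict Ω) :=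
  hu.1.mono_exponent (ENNReal.ofReal_le_ofReal hqp)

lemma MemW1.memLp_two [IsFiniteMeasure (volume.restrict Ω)] (hp : 2 ≤ p) (hu : MemW1 Ω p u) :
    MemLp u 2 (volume.restrict Ω) := by
  simpa using hu.memLp hp

lemma MemW1.integrable [IsFiniteMeasure (volume.restrict Ω)] (hp : 1 ≤ p) (hu : MemW1 Ω p u) :
    Integrable u (volume.restrict Ω) :=
  hu.1.integrable (by simpa using hp)

lemma IsEllipticCoefficient.integrable_mul (hμ : IsEllipticCoefficient Ω μ₁ μ₂ μ) {f : Plane → ℝ}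
    (hf : Integrable f (volume.restrict Ω)) :
    Integrable (fun x => μ x * f x) (volume.restrict Ω) :=
  integrable_mul_of_ae_bounds hμ.aemeasurable hμ.ae_bounds hf

lemma sobolevEnergy_nonneg : 0 ≤ sobolevEnergy Ω p u := by
  unfold sobolevEnergy
  positivity

lemma dissipation_nonneg {α : ℝ} : 0 ≤ dissipation Ω α u v :=
  integral_nonneg fun _ => sq_nonneg _

lemma penaltyEnergy_nonneg : 0 ≤ penaltyEnergy Ω u :=
  integral_nonneg fun _ => sq_nonneg _

lemma penaltyEnergy_eq_zero (hu : ∀ᵐ x ∂volume.restrict Ω, 0 ≤ u x) : penaltyEnergy Ω u = 0 :=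
  integral_eq_zero_of_ae (hu.mono fun x hx => by simp [negPart_of_nonneg hx])

lemma IsEllipticCoefficient.integral_rpow_le_weightedEnergy
    (hμ : IsEllipticCoefficient Ω μ₁ μ₂ μ) (hΩ : IsOpen Ω) (hp : 0 < p) (hu : MemW1 Ω p u) :
    μ₁ * (∫ x in Ω, ‖weakGradient Ω u x‖ ^ p) ≤ weightedEnergy Ω p μ u := by
  have hint := hu.integrable_norm_weakGradient_rpow hΩ hp
  rw [← integral_const_mul]
  refine integral_mono_ae (hint.const_mul _) (hμ.integrable_mul hint)
    (hμ.ae_bounds.mono fun x hx => ?_)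
  have := hx.1
  dsimp only
  gcongr

lemma IsEllipticCoefficient.weightedEnergy_nonneg (hμ : IsEllipticCoefficient Ω μ₁ μ₂ μ) :
    0 ≤ weightedEnergy Ω p μ u :=
  integral_nonneg_of_ae (hμ.ae_bounds.mono fun _ hx =>
    mul_nonneg (hμ.pos.le.trans hx.1) (Real.rpow_nonneg (norm_nonneg _) _))

end Functionals

section EnergyStep

variable {Ω : Set Plane} {p α κ l μ₁ μ₂ : ℝ} {μ u v : Plane → ℝ}

lemma mul_dissipation_le [IsFiniteMeasure (volume.restrict Ω)] (hα : 1 < α) (hα₂ : α ≤ 2)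
    (hαp : α ≤ p) (hu : MemW1 Ω p u) (hv : MemW1 Ω p v) :
    (α - 1) * dissipation Ω α u v ≤
      ∫ x in Ω, (oddPow (α - 2) (v x) - oddPow (α - 2) (u x)) * (v x - u x) := by
  have hu' := hu.memLp hαp
  have hv' := hv.memLp hαp
  rw [dissipation, ← integral_const_mul]
  refine integral_mono_of_nonneg
    (ae_of_all _ fun x => mul_nonneg (by linarith) (sq_nonneg _)) ?_
    (ae_of_all _ fun x => oddPow_strong_monotone hα hα₂ (u x) (v x))
  simp only [sub_mul]
  exact (integrable_oddPow_mul hα hv' (hv'.sub hu')).sub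
    (integrable_oddPow_mul hα hu' (hv'.sub hu'))

lemma IsEllipticCoefficient.weightedEnergy_sub_le (hμ : IsEllipticCoefficient Ω μ₁ μ₂ μ)
    (hΩ : IsOpen Ω) (hp : 1 < p) (hu : MemW1 Ω p u) (hv : MemW1 Ω p v) :
    (weightedEnergy Ω p μ v - weightedEnergy Ω p μ u) / p ≤
      pLaplacian Ω p μ v (fun x => v x - u x) := by
  have hint {w : Plane → ℝ} (hw : MemW1 Ω p w) :=
    hμ.integrable_mul (hw.integrable_norm_weakGradient_rpow hΩ (by linarith))
  rw [weightedEnergy, weightedEnergy, ← integral_sub (hint hv) (hint hu), ← integral_div]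
  refine integral_mono_ae (((hint hv).sub (hint hu)).div_const p)
    (hμ.integrable_mul (integrable_rpow_norm_mul_inner hp (hv.memLp_weakGradient hΩ)
      ((hv.sub hΩ hu).memLp_weakGradient hΩ))) ?_
  filter_upwards [hv.weakGradient_sub hΩ hu, hμ.ae_bounds] with x hx hμx
  rw [hx, ← mul_sub, mul_div_assoc]
  exact mul_le_mul_of_nonneg_left (rpow_norm_sub_le_inner hp.le _ _) (hμ.pos.le.trans hμx.1)

lemma integral_negPart_mul_sub_le (hu : MemLp u 2 (volume.restrict Ω))
    (hv : MemLp v 2 (volume.restrict Ω)) :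
    ∫ x in Ω, negPart (v x) * (v x - u x) ≤ (penaltyEnergy Ω u - penaltyEnergy Ω v) / 2 := by
  have hu' := (memLp_negPart hu).integrable_sq
  have hv' := (memLp_negPart hv).integrable_sq
  rw [penaltyEnergy, penaltyEnergy, ← integral_sub hu' hv', ← integral_div]
  exact integral_mono ((memLp_negPart hv).integrable_mul (hv.sub hu)) ((hu'.sub hv').div_const 2)
    fun x => negPart_mul_sub_le (v x) (u x)

-- The step is tested with `v - u`; the penalty and the `p`-Laplacian are gradients of convex
-- functionals, so both of their contributions telescope.
theorem IsImplicitStep.energy_le [IsFiniteMeasure (volume.restrict Ω)] {f : closure Ω →ᵇ ℝ}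
    (h : IsImplicitStep Ω p α μ κ l f u v) (hΩ : IsOpen Ω)
    (hμ : IsEllipticCoefficient Ω μ₁ μ₂ μ) (hp : 2 ≤ p) (hα : 1 < α) (hα₂ : α ≤ 2) (hl : 0 < l)
    (hκ : 0 < κ) (hu : MemW10 Ω p u) (hv : MemW10 Ω p v) :
    (α - 1) / l * dissipation Ω α u v + (weightedEnergy Ω p μ v - weightedEnergy Ω p μ u) / p
      + (penaltyEnergy Ω v - penaltyEnergy Ω u) / (2 * κ) ≤ pairing f v - pairing f u := by
  have htest := h _ (hv.sub hΩ (by linarith) hu)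
  rw [pairing_sub_right f (hv.1.integrable (by linarith)) (hu.1.integrable (by linarith))] at htest
  have htime := mul_le_mul_of_nonneg_left (mul_dissipation_le hα hα₂ (hα₂.trans hp) hu.1 hv.1)
    (by positivity : 0 ≤ 1 / l)
  have hflux := hμ.weightedEnergy_sub_le hΩ (by linarith) hu.1 hv.1
  have hpenalty := mul_le_mul_of_nonneg_left
    (integral_negPart_mul_sub_le (hu.1.memLp_two hp) (hv.1.memLp_two hp))
    (by positivity : 0 ≤ 1 / κ)
  have htime_eq : (α - 1) / l * dissipation Ω α u v = 1 / l * ((α - 1) * dissipation Ω α u v) := by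
    ring
  have hpenalty_eq : (penaltyEnergy Ω v - penaltyEnergy Ω u) / (2 * κ) =
      -(1 / κ * ((penaltyEnergy Ω u - penaltyEnergy Ω v) / 2)) := by
    field_simp
    ring
  linarith

end EnergyStep

/-! ### Summation over the steps -/

section EnergyBound

variable {Ω : Set Plane} {p α κ l K μ₁ μ₂ : ℝ} {μ : Plane → ℝ} {f : ℕ → closure Ω →ᵇ ℝ} {N : ℕ}
  {u : ℕ → Plane → ℝ}

theorem IsImplicitScheme.sum_energy_le [IsFiniteMeasure (volume.restrict Ω)]
    (h : IsImplicitScheme Ω p α μ κ l f N u) (hΩ : IsOpen Ω)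
    (hμ : IsEllipticCoefficient Ω μ₁ μ₂ μ) (hp : 2 ≤ p) (hα : 1 < α) (hα₂ : α ≤ 2) (hl : 0 < l)
    (hκ : 0 < κ) (hu0 : ∀ᵐ x ∂volume.restrict Ω, 0 ≤ u 0 x) {m : ℕ} (hm : m ≤ N) :
    (α - 1) / l * (∑ n ∈ Finset.range m, dissipation Ω α (u n) (u (n + 1)))
      + (weightedEnergy Ω p μ (u m) - weightedEnergy Ω p μ (u 0)) / p
      ≤ ∑ n ∈ Finset.range m, (pairing (f n) (u (n + 1)) - pairing (f n) (u n)) := by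
  have hsum := Finset.sum_le_sum fun n (hn : n ∈ Finset.range m) =>
    have hnN : n < N := (Finset.mem_range.1 hn).trans_le hm
    (h.isImplicitStep n hnN).energy_le hΩ hμ hp hα hα₂ hl hκ (h.memW10 n hnN.le)
      (h.memW10 (n + 1) hnN)
  rw [Finset.sum_add_distrib, Finset.sum_add_distrib, ← Finset.mul_sum, ← Finset.sum_div,
    ← Finset.sum_div, Finset.sum_range_sub fun n => weightedEnergy Ω p μ (u n),
    Finset.sum_range_sub fun n => penaltyEnergy Ω (u n), penaltyEnergy_eq_zero hu0,
    sub_zero] at hsum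
  have hpenalty : 0 ≤ penaltyEnergy Ω (u m) / (2 * κ) :=
    div_nonneg penaltyEnergy_nonneg (by positivity)
  linarith

lemma sum_range_succ_sub_eq_by_parts {G : Type*} [AddCommGroup G] (X : ℕ → ℕ → G) (m : ℕ) :
    ∑ n ∈ Finset.range (m + 1), (X n (n + 1) - X n n) =
      X m (m + 1) - X 0 0 - ∑ n ∈ Finset.range m, (X (n + 1) (n + 1) - X n (n + 1)) := by
  induction m with
  | zero => simp
  | succ m ih =>
    rw [Finset.sum_range_succ, ih, Finset.sum_range_succ _ m]
    abel

theorem sum_pairing_sub_le {Y : ℝ} (hK : ∀ n < N, ‖f n‖ ≤ K)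
    (hKV : ∑ n ∈ Finset.range (N - 1), ‖f (n + 1) - f n‖ ≤ K)
    (hu : ∀ n ≤ N, Integrable (u n) (volume.restrict Ω)) (hY : ∀ n ≤ N, ∫ x in Ω, |u n x| ≤ Y)
    {m : ℕ} (hm : m ≤ N) :
    ∑ n ∈ Finset.range m, (pairing (f n) (u (n + 1)) - pairing (f n) (u n)) ≤ 3 * K * Y := by
  have hK0 : 0 ≤ K := (Finset.sum_nonneg fun _ _ => norm_nonneg _).trans hKV
  have hY0 : 0 ≤ Y := (integral_nonneg fun _ => abs_nonneg _).trans (hY 0 N.zero_le)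
  have hpair (g : closure Ω →ᵇ ℝ) {k : ℕ} (hk : k ≤ N) : |pairing g (u k)| ≤ ‖g‖ * Y :=
    (abs_pairing_le g (hu k hk)).trans (mul_le_mul_of_nonneg_left (hY k hk) (norm_nonneg g))
  have hbound {n k : ℕ} (hn : n < N) (hk : k ≤ N) : |pairing (f n) (u k)| ≤ K * Y :=
    (hpair _ hk).trans (mul_le_mul_of_nonneg_right (hK n hn) hY0)
  rcases m with _ | m
  · simpa using by positivity
  have hvar : -∑ n ∈ Finset.range m, (pairing (f (n + 1)) (u (n + 1)) - pairing (f n) (u (n + 1)))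
      ≤ K * Y :=
    calc _ ≤ ∑ n ∈ Finset.range m, ‖f (n + 1) - f n‖ * Y := by
          rw [← Finset.sum_neg_distrib]
          refine Finset.sum_le_sum fun n hn => ?_
          have hnN : n + 1 ≤ N := by have := Finset.mem_range.1 hn; omega
          rw [← pairing_sub_left _ _ (hu _ hnN)]
          exact (neg_le_abs _).trans (hpair _ hnN)
      _ ≤ ∑ n ∈ Finset.range (N - 1), ‖f (n + 1) - f n‖ * Y :=
          Finset.sum_le_sum_of_subset_of_nonneg (Finset.range_subset_range.2 (by omega))
            fun n _ _ => by positivity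
      _ ≤ K * Y := by
          rw [← Finset.sum_mul]
          gcongr
  rw [sum_range_succ_sub_eq_by_parts fun n k => pairing (f n) (u k)]
  have hlast := (abs_le.1 (hbound (n := m) (by omega) hm)).2
  have hfirst := (abs_le.1 (hbound (n := 0) (k := 0) (by omega) N.zero_le)).1
  linarith

theorem IsEllipticCoefficient.exists_sobolevEnergy_le (hμ : IsEllipticCoefficient Ω μ₁ μ₂ μ)
    (hΩ : IsOpen Ω) (hΩb : Bornology.IsBounded Ω) (hp : 2 ≤ p) :
    ∃ C : ℝ, 0 < C ∧ ∀ v, MemW10 Ω p v → sobolevEnergy Ω p v ≤ C * weightedEnergy Ω p μ v := by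
  obtain ⟨C, hC, hpoincare⟩ := exists_poincare hΩ hΩb hp
  have hμ₁ := hμ.pos
  refine ⟨(C + 1) / μ₁, by positivity, fun v hv => ?_⟩
  calc sobolevEnergy Ω p v ≤ (C + 1) / μ₁ * (μ₁ * ∫ x in Ω, ‖weakGradient Ω v x‖ ^ p) := by
        rw [← mul_assoc, div_mul_cancel₀ _ hμ₁.ne', add_one_mul]
        exact add_le_add_left (hpoincare v hv) _
    _ ≤ _ := by
        gcongr
        exact hμ.integral_rpow_le_weightedEnergy hΩ (by linarith) hv.1

theorem IsEllipticCoefficient.exists_integral_abs_le (hμ : IsEllipticCoefficient Ω μ₁ μ₂ μ)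
    (hΩ : IsOpen Ω) (hΩb : Bornology.IsBounded Ω) (hp : 2 ≤ p) {ε : ℝ} (hε : 0 < ε) :
    ∃ D : ℝ, 0 ≤ D ∧ ∀ v, MemW10 Ω p v → ∫ x in Ω, |v x| ≤ ε * weightedEnergy Ω p μ v + D := by
  have : IsFiniteMeasure (volume.restrict Ω) :=
    isFiniteMeasure_restrict.2 hΩb.measure_lt_top.ne
  obtain ⟨C, hC, hcoercive⟩ := hμ.exists_sobolevEnergy_le hΩ hΩb hp
  set D : ℝ := (1 / (ε / C)) ^ (1 / (p - 1))
  refine ⟨volume.real Ω * D, by positivity, fun v hv => ?_⟩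
  have hint : Integrable (fun x => ε / C * |v x| ^ p) (volume.restrict Ω) :=
    (integrable_norm_rpow_of_memLp_ofReal (by linarith) hv.1.1).const_mul _
  calc ∫ x in Ω, |v x| ≤ ∫ x in Ω, (ε / C * |v x| ^ p + D) :=
        integral_mono (hv.1.integrable (by linarith)).abs (hint.add (integrable_const D))
          fun x => le_mul_rpow_add (abs_nonneg _) (by linarith) (by positivity)
    _ = ε / C * (∫ x in Ω, |v x| ^ p) + volume.real Ω * D := by
        rw [integral_add hint (integrable_const D), integral_const_mul, integral_const,
          measureReal_restrict_apply_univ, smul_eq_mul]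
    _ ≤ ε / C * sobolevEnergy Ω p v + volume.real Ω * D := by
        gcongr
        exact le_add_of_nonneg_right (by positivity)
    _ ≤ ε / C * (C * weightedEnergy Ω p μ v) + volume.real Ω * D := by
        gcongr
        exact hcoercive v hv
    _ = _ := by field_simp

-- With `ε = 1 / (6 p K)`, half of the largest energy absorbs the contribution of the source.
theorem IsImplicitScheme.energy_bound [IsFiniteMeasure (volume.restrict Ω)]
    (h : IsImplicitScheme Ω p α μ κ l f N u) (hΩ : IsOpen Ω)
    (hμ : IsEllipticCoefficient Ω μ₁ μ₂ μ) (hp : 2 ≤ p) (hα : 1 < α) (hα₂ : α ≤ 2) (hl : 0 < l)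
    (hκ : 0 < κ) (hu0 : ∀ᵐ x ∂volume.restrict Ω, 0 ≤ u 0 x) (hK0 : 0 < K)
    (hK : ∀ n < N, ‖f n‖ ≤ K) (hKV : ∑ n ∈ Finset.range (N - 1), ‖f (n + 1) - f n‖ ≤ K) {D : ℝ}
    (hD : ∀ v, MemW10 Ω p v →
      ∫ x in Ω, |v x| ≤ 1 / (6 * p * K) * weightedEnergy Ω p μ v + D) :
    (∀ n ≤ N, weightedEnergy Ω p μ (u n) ≤ 2 * weightedEnergy Ω p μ (u 0) + 6 * p * K * D) ∧
      (α - 1) / l * (∑ n ∈ Finset.range N, dissipation Ω α (u n) (u (n + 1))) ≤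
        2 / p * weightedEnergy Ω p μ (u 0) + 6 * K * D := by
  have hp0 : 0 < p := by linarith
  obtain ⟨k, hk, hmax⟩ := Finset.exists_max_image (Finset.range (N + 1))
    (fun n => weightedEnergy Ω p μ (u n)) ⟨0, by simp⟩
  simp only [Finset.mem_range, Nat.lt_succ_iff] at hk hmax
  set H₀ := weightedEnergy Ω p μ (u 0)
  set H := weightedEnergy Ω p μ (u k)
  have hL1 : ∀ n ≤ N, ∫ x in Ω, |u n x| ≤ 1 / (6 * p * K) * H + D := fun n hn =>
    (hD _ (h.memW10 n hn)).trans (by gcongr; exact hmax n hn)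
  have hsource : 3 * K * (1 / (6 * p * K) * H + D) = H / p / 2 + 3 * K * D := by
    field_simp
    ring
  have henergy {m : ℕ} (hm : m ≤ N) :
      (α - 1) / l * (∑ n ∈ Finset.range m, dissipation Ω α (u n) (u (n + 1)))
        + (weightedEnergy Ω p μ (u m) / p - H₀ / p) ≤ H / p / 2 + 3 * K * D := by
    rw [← sub_div, ← hsource]
    exact (h.sum_energy_le hΩ hμ hp hα hα₂ hl hκ hu0 hm).trans
      (sum_pairing_sub_le hK hKV (fun n hn => (h.memW10 n hn).1.integrable (by linarith)) hL1 hm)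
  have hdiss : 0 ≤ (α - 1) / l * ∑ n ∈ Finset.range k, dissipation Ω α (u n) (u (n + 1)) :=
    mul_nonneg (div_nonneg (by linarith) hl.le) (Finset.sum_nonneg fun _ _ => dissipation_nonneg)
  have hH : H / p ≤ 2 * (H₀ / p) + 6 * K * D := by linarith [henergy hk]
  refine ⟨fun n hn => (hmax n hn).trans ?_, ?_⟩
  · calc H = p * (H / p) := (mul_div_cancel₀ H hp0.ne').symm
      _ ≤ p * (2 * (H₀ / p) + 6 * K * D) := by gcongr
      _ = 2 * H₀ + 6 * p * K * D := by field_simp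
  · have hlast : 0 ≤ weightedEnergy Ω p μ (u N) / p := div_nonneg hμ.weightedEnergy_nonneg hp0.le
    have hH₀ : 2 / p * H₀ = 2 * (H₀ / p) := by ring
    linarith [henergy le_rfl]

lemma weightedEnergy_congr_ae (hΩ : IsOpen Ω) {v w : Plane → ℝ} (hv : MemW1 Ω p v)
    (hw : MemW1 Ω p w) (hvw : v =ᵐ[volume.restrict Ω] w) :
    weightedEnergy Ω p μ v = weightedEnergy Ω p μ w :=
  integral_congr_ae <| (hv.hasWeakGradient.ae_eq hΩ hw.hasWeakGradient hvw).mono fun x hx => by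
    simp only [hx]

theorem exists_uniform_bound (hΩ : IsOpen Ω) (hΩb : Bornology.IsBounded Ω) {T : ℝ} (hT : 0 < T)
    (hp : 2 ≤ p) (hμ : IsEllipticCoefficient Ω μ₁ μ₂ μ) {a : ℝ → closure Ω →ᵇ ℝ}
    (ha : MemW1Time T p a) {u₀ : Plane → ℝ} (hu₀ : MemW10 Ω p u₀)
    (hu₀' : ∀ᵐ x ∂volume.restrict Ω, 0 ≤ u₀ x) :
    ∃ S : ℝ, 1 ≤ S ∧ ∀ κ : ℝ, 0 < κ → ∀ N : ℕ, 1 ≤ N → ∀ u : ℕ → Plane → ℝ,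
      IsSemiDiscreteSolution Ω p T μ a u₀ κ N u →
      (∀ n ≤ N, sobolevEnergy Ω p (u n) ≤ S) ∧
      1 / step T N * (∑ n ∈ Finset.range N, dissipation Ω (alpha p) (u n) (u (n + 1))) ≤ S ∧
      ∀ n < N, ‖cellAverage (step T N) a n‖ ≤ S := by
  have : IsFiniteMeasure (volume.restrict Ω) :=
    isFiniteMeasure_restrict.2 hΩb.measure_lt_top.ne
  have hα := one_lt_alpha (by linarith : 1 < p)
  have hα₀ : 0 < alpha p - 1 := by linarith
  obtain ⟨K, hK, haverage⟩ := ha.exists_cellAverage_bound hT (by linarith)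
  obtain ⟨C, hC, hcoercive⟩ := hμ.exists_sobolevEnergy_le hΩ hΩb hp
  obtain ⟨D, hD, hintegral⟩ :=
    hμ.exists_integral_abs_le hΩ hΩb hp (by positivity : 0 < 1 / (6 * p * K))
  set H₀ := weightedEnergy Ω p μ u₀
  have hH₀ : 0 ≤ H₀ := hμ.weightedEnergy_nonneg
  set B := C * (2 * H₀ + 6 * p * K * D)
  have hB : 0 ≤ B := by positivity
  set B' := (2 / p * H₀ + 6 * K * D) / (alpha p - 1)
  have hB' : 0 ≤ B' := by positivity
  refine ⟨1 + B + B' + K, by linarith, fun κ hκ N hN u hu => ?_⟩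
  obtain ⟨hKN, hKV⟩ := haverage N hN
  have hl : 0 < step T N := step_pos hT hN
  have hscheme := hu.isImplicitScheme
  obtain ⟨henergy, hdiss⟩ := hscheme.energy_bound hΩ hμ hp hα (alpha_le_two (by linarith)) hl hκ
    (by filter_upwards [hu.1, hu₀'] with x hx hx₀ using hx ▸ hx₀) hK hKN hKV hintegral
  rw [weightedEnergy_congr_ae hΩ (hscheme.memW10 0 N.zero_le).1 hu₀.1 hu.1] at henergy hdiss
  refine ⟨fun n hn => ?_, ?_, fun n hn => (hKN n hn).trans (by linarith)⟩
  · have := (hcoercive _ (hscheme.memW10 n hn)).trans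
      (mul_le_mul_of_nonneg_left (henergy n hn) hC.le)
    linarith
  · refine ((le_div_iff₀ hα₀).2 (le_trans (le_of_eq ?_) hdiss)).trans
      (by linarith : B' ≤ 1 + B + B' + K)
    ring

end EnergyBound

/-! ### Norm and dual norm estimates -/

section Norms

variable {Ω : Set Plane} {p S : ℝ} {u v w : Plane → ℝ}

lemma w1Norm_rpow_le (hΩ : IsOpen Ω) (hp : 0 < p) (hu : MemW1 Ω p u)
    (hS : sobolevEnergy Ω p u ≤ S) : w1Norm Ω p u ^ p ≤ ENNReal.ofReal S :=
  (w1Norm_rpow_eq hΩ hp hu).trans_le (ENNReal.ofReal_le_ofReal hS)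

lemma w1Norm_le (hΩ : IsOpen Ω) (hp : 1 ≤ p) (hu : MemW1 Ω p u) (hS₁ : 1 ≤ S)
    (hS : sobolevEnergy Ω p u ≤ S) : w1Norm Ω p u ≤ ENNReal.ofReal S := by
  have hp0 : 0 < p := by linarith
  rw [← ENNReal.rpow_le_rpow_iff hp0, ENNReal.ofReal_rpow_of_nonneg (by linarith) hp0.le]
  exact w1Norm_rpow_le hΩ hp0 hu (hS.trans (Real.self_le_rpow_of_one_le hS₁ hp))

lemma sobolevEnergy_le_one (hΩ : IsOpen Ω) (hp : 0 < p) (hu : MemW1 Ω p u)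
    (h : w1Norm Ω p u ≤ 1) : sobolevEnergy Ω p u ≤ 1 := by
  rw [← ENNReal.ofReal_le_one, ← w1Norm_rpow_eq hΩ hp hu]
  exact ENNReal.rpow_le_one h hp.le

lemma eLpNorm_le_mul_w1Norm (hΩb : Bornology.IsBounded Ω) {q : ℝ} (hq : 1 ≤ q) (hqp : q ≤ p)
    (hu : AEStronglyMeasurable u (volume.restrict Ω)) :
    eLpNorm u (ENNReal.ofReal q) (volume.restrict Ω) ≤
      w1Norm Ω p u * ENNReal.ofReal (1 + volume.real Ω) := by
  have hq0 : 0 < q := by linarith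
  have hθ : 0 ≤ 1 / q - 1 / p := sub_nonneg.2 (one_div_le_one_div_of_le hq0 hqp)
  have hθ₁ : 1 / q - 1 / p ≤ 1 := by
    have : 1 / q ≤ 1 := (div_le_one hq0).2 hq
    have : 0 ≤ 1 / p := one_div_nonneg.2 (hq0.le.trans hqp)
    linarith
  refine (eLpNorm_le_eLpNorm_mul_rpow_measure_univ (ENNReal.ofReal_le_ofReal hqp) hu).trans ?_
  rw [Measure.restrict_apply_univ, ENNReal.toReal_ofReal hq0.le,
    ENNReal.toReal_ofReal (hq0.le.trans hqp), ← ofReal_measureReal hΩb.measure_lt_top.ne]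
  gcongr
  · exact eLpNorm_le_w1Norm Ω (hq0.trans_le hqp) u
  · rw [ENNReal.ofReal_rpow_of_nonneg measureReal_nonneg hθ]
    refine ENNReal.ofReal_le_ofReal ?_
    simpa using rpow_le_one_add_rpow (s := volume.real Ω) measureReal_nonneg hθ hθ₁

lemma MemW1.eLpNorm_le (hΩ : IsOpen Ω) (hΩb : Bornology.IsBounded Ω) {q : ℝ} (hq : 1 ≤ q)
    (hqp : q ≤ p) (hu : MemW1 Ω p u) (hS₁ : 1 ≤ S) (hS : sobolevEnergy Ω p u ≤ S) :
    eLpNorm u (ENNReal.ofReal q) (volume.restrict Ω) ≤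
      ENNReal.ofReal (S * (1 + volume.real Ω)) := by
  rw [ENNReal.ofReal_mul (by linarith)]
  refine (eLpNorm_le_mul_w1Norm hΩb hq hqp hu.1.1).trans ?_
  gcongr
  exact w1Norm_le hΩ (hq.trans hqp) hu hS₁ hS

lemma eLpNorm_oddPow_le {X : Type*} [MeasurableSpace X] {ν : Measure X} {q r s : ℝ} {B : ℝ≥0∞}
    {f : X → ℝ} (hq : -1 < q) (hq₀ : q ≤ 0) (hr : 0 ≤ r) (hs : r * (q + 1) = s) (hB : 1 ≤ B)
    (h : eLpNorm f (ENNReal.ofReal s) ν ≤ B) :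
    eLpNorm (fun x => oddPow q (f x)) (ENNReal.ofReal r) ν ≤ B := by
  rw [eLpNorm_oddPow hq hr, hs]
  calc eLpNorm f (ENNReal.ofReal s) ν ^ (q + 1) ≤ B ^ (q + 1) :=
        ENNReal.rpow_le_rpow h (by linarith)
    _ ≤ B ^ (1 : ℝ) := ENNReal.rpow_le_rpow_of_exponent_le hB (by linarith)
    _ = B := ENNReal.rpow_one B

lemma eLpNorm_oddPow_half_le {X : Type*} [MeasurableSpace X] {ν : Measure X} {α : ℝ} {B : ℝ≥0∞}
    {f : X → ℝ} (hα : 0 < α) (hα₂ : α ≤ 2) (hB : 1 ≤ B)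
    (h : eLpNorm f (ENNReal.ofReal α) ν ≤ B) :
    eLpNorm (fun x => oddPow ((α - 2) / 2) (f x)) 2 ν ≤ B := by
  simpa using eLpNorm_oddPow_le (by linarith) (by linarith) zero_le_two (by ring) hB h

lemma eLpNorm_oddPow_conjExponent_le {X : Type*} [MeasurableSpace X] {ν : Measure X} {α : ℝ}
    {B : ℝ≥0∞} {f : X → ℝ} (hα : 1 < α) (hα₂ : α ≤ 2) (hB : 1 ≤ B)
    (h : eLpNorm f (ENNReal.ofReal α) ν ≤ B) :
    eLpNorm (fun x => oddPow (α - 2) (f x)) (ENNReal.ofReal (α / (α - 1))) ν ≤ B := by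
  have hα₁ : 0 < α - 1 := sub_pos.2 hα
  refine eLpNorm_oddPow_le (by linarith) (by linarith) (by positivity) ?_ hB h
  field_simp
  ring

lemma ofReal_step_mul_sum_le {T : ℝ} (hT : 0 < T) {N : ℕ} (hN : 1 ≤ N) (hS₀ : 0 ≤ S)
    {F : ℕ → ℝ≥0∞} (hF : ∀ n ≤ N, F n ≤ ENNReal.ofReal S) :
    ENNReal.ofReal (step T N) * ∑ n ∈ Finset.range (N + 1), F n ≤ ENNReal.ofReal (2 * T * S) := by
  have hN₁ : (1 : ℝ) ≤ N := by exact_mod_cast hN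
  calc _ ≤ ENNReal.ofReal (step T N) * ∑ _n ∈ Finset.range (N + 1), ENNReal.ofReal S := by
        gcongr with n hn
        exact hF n (Nat.lt_succ_iff.1 (Finset.mem_range.1 hn))
    _ = ENNReal.ofReal (step T N * ((N + 1) * S)) := by
        rw [Finset.sum_const, Finset.card_range, nsmul_eq_mul, ← ENNReal.ofReal_natCast,
          ← ENNReal.ofReal_mul (by positivity), ← ENNReal.ofReal_mul (step_pos hT hN).le]
        push_cast
        rfl
    _ ≤ ENNReal.ofReal (2 * T * S) := by
        refine ENNReal.ofReal_le_ofReal ?_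
        have hlT : step T N * (N + 1) ≤ 2 * T := by
          rw [step, div_mul_eq_mul_div, div_le_iff₀ (by linarith)]
          nlinarith
        rw [← mul_assoc]
        gcongr

lemma ofReal_mul_sum_eLpNorm_div_sq {X : Type*} [MeasurableSpace X] {ν : Measure X} {l : ℝ}
    (hl : 0 < l) (N : ℕ) {f : ℕ → X → ℝ} (hf : ∀ n < N, MemLp (f n) 2 ν) :
    ENNReal.ofReal l * ∑ n ∈ Finset.range N, eLpNorm (fun x => f n x / l) 2 ν ^ 2 =
      ENNReal.ofReal (1 / l * ∑ n ∈ Finset.range N, ∫ x, f n x ^ 2 ∂ν) := by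
  have hterm : ∀ n ∈ Finset.range N, eLpNorm (fun x => f n x / l) 2 ν ^ 2 =
      ENNReal.ofReal (1 / l ^ 2 * ∫ x, f n x ^ 2 ∂ν) := fun n hn => by
    have hdiv : MemLp (fun x => f n x / l) (ENNReal.ofReal 2) ν := by
      simpa [div_eq_mul_inv] using (hf n (Finset.mem_range.1 hn)).mul_const l⁻¹
    have hsq := eLpNorm_ofReal_rpow_eq two_pos hdiv
    simp only [ENNReal.ofReal_ofNat, ENNReal.rpow_ofNat, Real.rpow_ofNat, Real.norm_eq_abs,
      sq_abs, div_pow] at hsq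
    rw [hsq, integral_div, one_div_mul_eq_div]
  rw [Finset.sum_congr rfl hterm, ← ENNReal.ofReal_sum_of_nonneg fun n _ => by positivity,
    ← ENNReal.ofReal_mul hl.le, ← Finset.mul_sum]
  congr 1
  field_simp

lemma MemW1.memLp_oddPow_half [IsFiniteMeasure (volume.restrict Ω)] {α : ℝ} (hα : 0 < α)
    (hαp : α ≤ p) (hu : MemW1 Ω p u) :
    MemLp (fun x => oddPow ((α - 2) / 2) (u x)) 2 (volume.restrict Ω) := by
  have hexp : 2 * ((α - 2) / 2 + 1) = α := by ring
  simpa using memLp_oddPow (by linarith) zero_le_two (hexp.symm ▸ hu.memLp hαp)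

lemma ofReal_mul_sum_eLpNorm_sq_eq_dissipation [IsFiniteMeasure (volume.restrict Ω)] {α l : ℝ}
    (hα : 0 < α) (hαp : α ≤ p) (hl : 0 < l) {N : ℕ} {u : ℕ → Plane → ℝ}
    (hu : ∀ n ≤ N, MemW1 Ω p (u n)) :
    ENNReal.ofReal l * ∑ n ∈ Finset.range N,
        eLpNorm (fun x => (oddPow ((α - 2) / 2) (u (n + 1) x) - oddPow ((α - 2) / 2) (u n x)) / l)
          2 (volume.restrict Ω) ^ 2 =
      ENNReal.ofReal (1 / l * ∑ n ∈ Finset.range N, dissipation Ω α (u n) (u (n + 1))) :=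
  ofReal_mul_sum_eLpNorm_div_sq hl N fun n hn =>
    ((hu (n + 1) hn).memLp_oddPow_half hα hαp).sub ((hu n hn.le).memLp_oddPow_half hα hαp)

end Norms

section Dual

variable {Ω : Set Plane} {p α κ l S μ₁ μ₂ : ℝ} {μ u v w : Plane → ℝ}

lemma MemW1.integrable_one_add_rpow [IsFiniteMeasure (volume.restrict Ω)] (hp : 0 < p)
    (hv : MemW1 Ω p v) : Integrable (fun x => 1 + |v x| ^ p) (volume.restrict Ω) :=
  (integrable_const 1).add (integrable_norm_rpow_of_memLp_ofReal hp hv.1)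

lemma MemW1.integral_one_add_rpow_le [IsFiniteMeasure (volume.restrict Ω)] (hp : 0 < p)
    (hv : MemW1 Ω p v) : ∫ x in Ω, (1 + |v x| ^ p) ≤ volume.real Ω + sobolevEnergy Ω p v := by
  have hint : Integrable (fun x => |v x| ^ p) (volume.restrict Ω) :=
    integrable_norm_rpow_of_memLp_ofReal hp hv.1
  rw [integral_add (integrable_const 1) hint, integral_const, measureReal_restrict_apply_univ,
    smul_eq_mul, mul_one, sobolevEnergy]
  gcongr
  exact le_add_of_nonneg_right (by positivity)

lemma abs_pairing_le_sobolevEnergy [IsFiniteMeasure (volume.restrict Ω)] (hp : 1 ≤ p)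
    (f : closure Ω →ᵇ ℝ) (hw : MemW1 Ω p w) :
    |pairing f w| ≤ ‖f‖ * (volume.real Ω + sobolevEnergy Ω p w) := by
  have hp0 : 0 < p := by linarith
  refine (abs_pairing_le f (hw.integrable hp)).trans ?_
  gcongr
  refine le_trans ?_ (hw.integral_one_add_rpow_le hp0)
  refine integral_mono (hw.integrable hp).abs (hw.integrable_one_add_rpow hp0) fun x => ?_
  simpa using rpow_le_one_add_rpow (abs_nonneg (w x)) zero_le_one hp

lemma IsEllipticCoefficient.abs_pLaplacian_le (hμ : IsEllipticCoefficient Ω μ₁ μ₂ μ)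
    (hΩ : IsOpen Ω) (hp : 1 < p) (hv : MemW1 Ω p v) (hw : MemW1 Ω p w) :
    |pLaplacian Ω p μ v w| ≤ |μ₂| * (sobolevEnergy Ω p v + sobolevEnergy Ω p w) := by
  have hp0 : 0 < p := by linarith
  have hv' := hv.integrable_norm_weakGradient_rpow hΩ hp0
  have hw' := hw.integrable_norm_weakGradient_rpow hΩ hp0
  calc |pLaplacian Ω p μ v w|
      ≤ ∫ x in Ω, |μ₂| * (‖weakGradient Ω v x‖ ^ p + ‖weakGradient Ω w x‖ ^ p) := by
        rw [pLaplacian, ← Real.norm_eq_abs]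
        refine norm_integral_le_of_norm_le ((hv'.add hw').const_mul _)
          (hμ.ae_bounds.mono fun x hx => ?_)
        rw [norm_mul]
        exact mul_le_mul (abs_le_abs_of_nonneg (hμ.pos.le.trans hx.1) hx.2)
          (abs_rpow_mul_inner_le hp _ _) (norm_nonneg _) (abs_nonneg _)
    _ ≤ _ := by
        rw [integral_const_mul, integral_add hv' hw', sobolevEnergy, sobolevEnergy]
        gcongr <;> exact le_add_of_nonneg_left (by positivity)

lemma abs_negPart_mul_le (hp : 2 ≤ p) (s t : ℝ) :
    |negPart s * t| ≤ (1 + |s| ^ p) + (1 + |t| ^ p) := by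
  have hs := rpow_le_one_add_rpow (abs_nonneg s) zero_le_two hp
  have ht := rpow_le_one_add_rpow (abs_nonneg t) zero_le_two hp
  rw [Real.rpow_two] at hs ht
  calc |negPart s * t| ≤ |s| * |t| := by
        rw [abs_mul, abs_of_nonneg (negPart_nonneg s)]
        gcongr
        exact negPart_le_abs s
    _ ≤ |s| ^ 2 + |t| ^ 2 := by nlinarith [sq_nonneg (|s| - |t|), sq_nonneg |s|, sq_nonneg |t|]
    _ ≤ _ := by gcongr

lemma abs_integral_negPart_mul_le [IsFiniteMeasure (volume.restrict Ω)] (hp : 2 ≤ p)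
    (hv : MemW1 Ω p v) (hw : MemW1 Ω p w) :
    |∫ x in Ω, negPart (v x) * w x| ≤
      2 * volume.real Ω + sobolevEnergy Ω p v + sobolevEnergy Ω p w := by
  have hp0 : 0 < p := by linarith
  have hv' := hv.integrable_one_add_rpow hp0
  have hw' := hw.integrable_one_add_rpow hp0
  rw [← Real.norm_eq_abs]
  refine (norm_integral_le_of_norm_le (hv'.add hw')
    (ae_of_all _ fun x => abs_negPart_mul_le hp (v x) (w x))).trans ?_
  simp only [Pi.add_apply]
  rw [integral_add hv' hw']
  linarith [hv.integral_one_add_rpow_le hp0, hw.integral_one_add_rpow_le hp0]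

theorem IsImplicitStep.dualNorm_le [IsFiniteMeasure (volume.restrict Ω)] {f : closure Ω →ᵇ ℝ}
    (h : IsImplicitStep Ω p α μ κ l f u v) (hΩ : IsOpen Ω)
    (hμ : IsEllipticCoefficient Ω μ₁ μ₂ μ) (hp : 2 ≤ p) (hκ : 0 < κ) (hv : MemW10 Ω p v)
    (hf : ‖f‖ ≤ S) (hS : sobolevEnergy Ω p v ≤ S) :
    dualNorm Ω p (fun x => (oddPow (α - 2) (v x) - oddPow (α - 2) (u x)) / l) ≤
      ENNReal.ofReal ((S * (volume.real Ω + 1) + |μ₂| * (S + 1) +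
        (2 * volume.real Ω + S + 1)) * (1 + 1 / κ)) := by
  refine iSup_le fun w => iSup_le fun hw => iSup_le fun hw₁ => ?_
  have hwE := sobolevEnergy_le_one hΩ (by linarith) hw.1 hw₁
  have hwE₀ : 0 ≤ sobolevEnergy Ω p w := sobolevEnergy_nonneg
  have hS₀ : 0 ≤ S := (norm_nonneg f).trans hf
  have hsource : |pairing f w| ≤ S * (volume.real Ω + 1) :=
    (abs_pairing_le_sobolevEnergy (by linarith) f hw.1).trans (by gcongr)
  have hflux : |pLaplacian Ω p μ v w| ≤ |μ₂| * (S + 1) :=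
    (hμ.abs_pLaplacian_le hΩ (by linarith) hv.1 hw.1).trans (by gcongr)
  have hpenalty : |1 / κ * ∫ x in Ω, negPart (v x) * w x| ≤
      1 / κ * (2 * volume.real Ω + S + 1) := by
    rw [abs_mul, abs_of_pos (by positivity : 0 < 1 / κ)]
    gcongr
    exact (abs_integral_negPart_mul_le hp hv.1 hw.1).trans (by gcongr)
  have hstep : ∫ x in Ω, (oddPow (α - 2) (v x) - oddPow (α - 2) (u x)) / l * w x =
      pairing f w - pLaplacian Ω p μ v w + 1 / κ * ∫ x in Ω, negPart (v x) * w x := by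
    rw [← h w hw]
    simp only [div_mul_eq_mul_div, integral_div]
    ring
  rw [hstep, Real.enorm_eq_ofReal_abs]
  refine ENNReal.ofReal_le_ofReal ?_
  calc _ ≤ |pairing f w| + |pLaplacian Ω p μ v w| +
        |1 / κ * ∫ x in Ω, negPart (v x) * w x| :=
        (abs_add_le _ _).trans (add_le_add_left (abs_sub _ _) _)
    _ ≤ S * (volume.real Ω + 1) + |μ₂| * (S + 1) + 1 / κ * (2 * volume.real Ω + S + 1) := by
        gcongr
    _ ≤ _ := by
        have : 0 ≤ 1 / κ * (S * (volume.real Ω + 1) + |μ₂| * (S + 1)) := by positivity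
        have : 0 ≤ 2 * volume.real Ω + S + 1 := by positivity
        linarith

end Dual

end IceSheet

end

open IceSheet in
theorem mainTheorem3_general {Ω : Set Plane} (hΩ : IsOpen Ω) (hΩb : Bornology.IsBounded Ω)
    {T : ℝ} (hT : 0 < T) {p : ℝ} (hp : 2 ≤ p) {μ : Plane → ℝ} {μ₁ μ₂ : ℝ}
    (hμ : IsEllipticCoefficient Ω μ₁ μ₂ μ) {a : ℝ → closure Ω →ᵇ ℝ} (ha : MemW1Time T p a)
    {u₀ : Plane → ℝ} (hu₀ : MemW10 Ω p u₀) (hu₀' : ∀ᵐ x ∂volume.restrict Ω, 0 ≤ u₀ x) :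
    ∃ C : ℝ, 0 < C ∧ ∀ κ : ℝ, 0 < κ → ∀ N : ℕ, 1 ≤ N → ∀ u : ℕ → Plane → ℝ,
      IsSemiDiscreteSolution Ω p T μ a u₀ κ N u →
      (∀ n ≤ N, eLpNorm (u n) (ENNReal.ofReal (alpha p)) (volume.restrict Ω)
        ≤ ENNReal.ofReal C) ∧
      (ENNReal.ofReal (step T N) * ∑ n ∈ Finset.range (N + 1), w1Norm Ω p (u n) ^ p
        ≤ ENNReal.ofReal C) ∧
      (ENNReal.ofReal (step T N) * ∑ n ∈ Finset.range N,
          eLpNorm (fun x => (oddPow ((alpha p - 2) / 2) (u (n + 1) x)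
            - oddPow ((alpha p - 2) / 2) (u n x)) / step T N) 2 (volume.restrict Ω) ^ 2
        ≤ ENNReal.ofReal C) ∧
      (∀ n ≤ N, eLpNorm (fun x => oddPow ((alpha p - 2) / 2) (u n x)) 2 (volume.restrict Ω)
        ≤ ENNReal.ofReal C) ∧
      (∀ n ≤ N, w1Norm Ω p (u n) ≤ ENNReal.ofReal C) ∧
      (∀ n < N, dualNorm Ω p (fun x =>
          (oddPow (alpha p - 2) (u (n + 1) x) - oddPow (alpha p - 2) (u n x)) / step T N)
        ≤ ENNReal.ofReal (C * (1 + 1 / κ))) ∧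
      (∀ n ≤ N, eLpNorm (fun x => oddPow (alpha p - 2) (u n x))
          (ENNReal.ofReal (alpha p / (alpha p - 1))) (volume.restrict Ω)
        ≤ ENNReal.ofReal C) := by
  have : IsFiniteMeasure (volume.restrict Ω) :=
    isFiniteMeasure_restrict.2 hΩb.measure_lt_top.ne
  have hα : 1 < alpha p := one_lt_alpha (by linarith)
  have hα₂ : alpha p ≤ 2 := alpha_le_two (by linarith)
  obtain ⟨S, hS, hbound⟩ := exists_uniform_bound hΩ hΩb hT hp hμ ha hu₀ hu₀'
  obtain ⟨C, hC⟩ := ({S * (1 + volume.real Ω), 2 * T * S, S, S * (volume.real Ω + 1) +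
    |μ₂| * (S + 1) + (2 * volume.real Ω + S + 1)} : Finset ℝ).bddAbove
  simp only [mem_upperBounds, Finset.coe_insert, Finset.coe_singleton, Set.forall_mem_insert,
    Set.mem_singleton_iff, forall_eq] at hC
  obtain ⟨hCα, hCT, hCS, hCD⟩ := hC
  refine ⟨C, by linarith, fun κ hκ N hN u hu => ?_⟩
  obtain ⟨henergy, hdiss, hsource⟩ := hbound κ hκ N hN u hu
  have hW n (hn : n ≤ N) : MemW1 Ω p (u n) := (hu.2.1 n hn).1
  have hC₁ : 1 ≤ ENNReal.ofReal C := ENNReal.one_le_ofReal.2 (hS.trans hCS)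
  have hLα n (hn : n ≤ N) := ((hW n hn).eLpNorm_le hΩ hΩb hα.le (hα₂.trans hp) hS
    (henergy n hn)).trans (ENNReal.ofReal_le_ofReal hCα)
  refine ⟨hLα, ?_, ?_, fun n hn => eLpNorm_oddPow_half_le (by linarith) hα₂ hC₁ (hLα n hn),
    fun n hn => w1Norm_le hΩ (by linarith) (hW n hn) (hS.trans hCS) ((henergy n hn).trans hCS),
    fun n hn => ?_, fun n hn => eLpNorm_oddPow_conjExponent_le hα hα₂ hC₁ (hLα n hn)⟩
  · exact (ofReal_step_mul_sum_le hT hN (by linarith) fun n hn =>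
      w1Norm_rpow_le hΩ (by linarith) (hW n hn) (henergy n hn)).trans
        (ENNReal.ofReal_le_ofReal hCT)
  · rw [ofReal_mul_sum_eLpNorm_sq_eq_dissipation (by linarith) (hα₂.trans hp)
      (step_pos hT hN) hW]
    exact ENNReal.ofReal_le_ofReal (hdiss.trans hCS)
  · refine ((hu.isImplicitScheme.isImplicitStep n hn).dualNorm_le hΩ hμ hp hκ (hu.2.1 _ hn)
      (hsource n hn) (henergy _ hn)).trans (ENNReal.ofReal_le_ofReal ?_)
    gcongr

theorem mainTheorem3
    (Ω : Set IceSheet.Plane) (hΩ : IceSheet.IsLipschitzDomain Ω)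
    (T : ℝ) (hT : 0 < T) (p : ℝ) (hp : 2.8 ≤ p) (hp' : p ≤ 5)
    (μ : IceSheet.Plane → ℝ) (hμ : AEMeasurable μ (volume.restrict Ω))
    (μ₁ μ₂ : ℝ) (hμ₁ : 0 < μ₁) (hμ₂ : 0 < μ₂) (hμb : ∀ x ∈ closure Ω, μ₁ ≤ μ x ∧ μ x ≤ μ₂)
    (a : ℝ → closure Ω →ᵇ ℝ) (ha : IceSheet.MemW1Time T p a)
    (u₀ : IceSheet.Plane → ℝ) (hu₀ : IceSheet.MemW10 Ω p u₀)
    (hu₀' : ∀ᵐ x ∂(volume.restrict Ω), 0 ≤ u₀ x)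
    (C₁ : ℝ) (hC₁ : 0 < C₁) :
    ∃ C : ℝ, 0 < C ∧ ∀ κ : ℝ, 0 < κ → ∀ N : ℕ, 1 ≤ N → ∀ u : ℕ → IceSheet.Plane → ℝ,
      IceSheet.IsSemiDiscreteSolution Ω p T μ a u₀ κ N u →
      1 / κ * (∑ n ∈ Finset.range N,
        ∫ x in Ω, IceSheet.negPart (u (n + 1) x) * (u (n + 1) x - u n x)) ≤ C₁ →
      (∀ n ≤ N, eLpNorm (u n) (ENNReal.ofReal (IceSheet.alpha p)) (volume.restrict Ω)
        ≤ ENNReal.ofReal C) ∧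
      (ENNReal.ofReal (IceSheet.step T N) *
          ∑ n ∈ Finset.range (N + 1), IceSheet.w1Norm Ω p (u n) ^ p
        ≤ ENNReal.ofReal C) ∧
      (ENNReal.ofReal (IceSheet.step T N) *
          ∑ n ∈ Finset.range N,
            eLpNorm (fun x =>
              (IceSheet.oddPow ((IceSheet.alpha p - 2) / 2) (u (n + 1) x)
                - IceSheet.oddPow ((IceSheet.alpha p - 2) / 2) (u n x)) / IceSheet.step T N)
              2 (volume.restrict Ω) ^ 2
        ≤ ENNReal.ofReal C) ∧
      (∀ n ≤ N, eLpNorm (fun x => IceSheet.oddPow ((IceSheet.alpha p - 2) / 2) (u n x))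
          2 (volume.restrict Ω)
        ≤ ENNReal.ofReal C) ∧
      (∀ n ≤ N, IceSheet.w1Norm Ω p (u n) ≤ ENNReal.ofReal C) ∧
      (∀ n < N, IceSheet.dualNorm Ω p (fun x =>
          (IceSheet.oddPow (IceSheet.alpha p - 2) (u (n + 1) x)
            - IceSheet.oddPow (IceSheet.alpha p - 2) (u n x)) / IceSheet.step T N)
        ≤ ENNReal.ofReal (C * (1 + 1 / κ))) ∧
      (∀ n ≤ N, eLpNorm (fun x => IceSheet.oddPow (IceSheet.alpha p - 2) (u n x))
          (ENNReal.ofReal (IceSheet.alpha p / (IceSheet.alpha p - 1))) (volume.restrict Ω)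
        ≤ ENNReal.ofReal C) := by
  have hμΩ : IceSheet.IsEllipticCoefficient Ω μ₁ μ₂ μ :=
    ⟨hμ, hμ₁, ae_restrict_of_forall_mem hΩ.1.measurableSet fun x hx => hμb x (subset_closure hx)⟩
  obtain ⟨C, hC, h⟩ :=
    mainTheorem3_general hΩ.1 hΩ.2.2.1 hT (by linarith) hμΩ ha hu₀ hu₀'
  exact ⟨C, hC, fun κ hκ N hN u hu _ => h κ hκ N hN u hu⟩
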